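/- A \emph{weighted polyhedral complex} in $\mathbb{R}^2$ means a finite polyhedral complex, pure of dimension $1$, with a positive real weight on each $1$-dimensional cell; its support is the union of its cells. It is \emph{balanced} if at every vertex the unit direction vectors of the $1$-cells emanating from it, multiplied by their weights, sum to $0$. Weight functions are extended by $0$ off the support, and weight functions of different complexes are compared, and added to form a sum of complexes, on a common refinement. A \emph{balancing} of a weighted polyhedral complex $X$ is a balanced weighted polyhedral complex $Y$ with $w_X\le w_Y$. For a balanced complex $Y$, the \emph{monomial length} $\mathrm{mlen}(Y)$ is the number of regions (connected components) of $\mathbb{R}^2\setminus Y$, and the \emph{factorization length} $\mathrm{flen}(Y)$ is the minimum of $\sum_{i=1}^m \mathrm{mlen}(Z_i)-(m-1)$ over all $m\ge 1$ and all decompositions $Y=Z_1+\dots+Z_m$ into balanced weighted polyhedral complexes. A balancing of $X$ is minimal with respect to $\mathrm{mlen}$ (respectively $\mathrm{flen}$) if no balancing of $X$ has smaller $\mathrm{mlen}$ (respectively $\mathrm{flen}$). \textbf{Theorem.} There exist a weighted polyhedral complex $X$ in $\mathbb{R}^2$, a balancing $Y_1$ of $X$ that is minimal with respect to $\mathrm{mlen}$,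 and a balancing $Y_2$ of $X$ that is minimal with respect to $\mathrm{flen}$, such that $\mathrm{mlen}(Y_1)<\mathrm{mlen}(Y_2)$ and $\mathrm{flen}(Y_1)>\mathrm{flen}(Y_2)$. -/

import Mathlib

open scoped InnerProductSpace

namespace TropicalBalancing

/-- Euclidean space `ℝᵈ`. -/
abbrev Space (d : ℕ) : Type := EuclideanSpace ℝ (Fin d)

/-- A (convex) polyhedron: a finite intersection of closed half-spaces. -/
def IsPolyhedron {d : ℕ} (P : Set (Space d)) : Prop :=
  ∃ (k : ℕ) (a : Fin k → Space d) (b : Fin k → ℝ), P = {x | ∀ i, ⟪a i, x⟫_ℝ ≤ b i}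

/-- The dimension of a (nonempty) convex set: the dimension of its affine span. -/
noncomputable def dim {d : ℕ} (P : Set (Space d)) : ℕ :=
  Module.finrank ℝ (vectorSpan ℝ P)

/-- A (finite) polyhedral complex in `ℝᵈ`: a finite collection of nonempty polyhedra, closed under
taking nonempty faces, any two of which are disjoint or meet in a common face. The faces of a
polyhedron are the subsets on which a linear functional is maximal (`IsExposed`; this includes the
polyhedron itself, and the empty set). -/
structure PolyhedralComplex (d : ℕ) where
  cells : Finset (Set (Space d))
  nonempty_of_mem : ∀ P ∈ cells, P.Nonempty
  isPolyhedron_of_mem : ∀ P ∈ cells, IsPolyhedron P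
  face_mem : ∀ P ∈ cells, ∀ F : Set (Space d), F.Nonempty → IsExposed ℝ P F → F ∈ cells
  inter_face : ∀ P ∈ cells, ∀ Q ∈ cells, IsExposed ℝ P (P ∩ Q) ∧ IsExposed ℝ Q (P ∩ Q)

/-- A positively weighted polyhedral complex, pure of codimension 1 in `ℝᵈ`. Only the values of
`weight` on the cells of dimension `d - 1` are meaningful. -/
structure WeightedComplex (d : ℕ) extends PolyhedralComplex d where
  pure : ∀ P ∈ cells, ∃ σ ∈ cells, dim σ + 1 = d ∧ P ⊆ σ
  weight : Set (Space d) → ℝ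
  weight_pos : ∀ σ ∈ cells, dim σ + 1 = d → 0 < weight σ

namespace WeightedComplex

variable {d : ℕ}

open Classical in
/-- The maximal cells, i.e. the cells of dimension `d - 1`. -/
noncomputable def facets (X : WeightedComplex d) : Finset (Set (Space d)) :=
  X.cells.filter fun σ => dim σ + 1 = d

/-- The support: the union of the maximal cells (all weights are positive). -/
def support (X : WeightedComplex d) : Set (Space d) :=
  {x | ∃ σ ∈ X.facets, x ∈ σ}

/-- The union of the cells of codimension at least 2 in `ℝᵈ`. -/
def skeleton (X : WeightedComplex d) : Set (Space d) :=
  {x | ∃ τ ∈ X.cells, dim τ + 2 ≤ d ∧ x ∈ τ}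

open Classical in
/-- The weight of `X` at a point `x` outside the skeleton: the weight of the unique maximal cell
containing `x`, and `0` if there is none. (On the skeleton this value is not used.) -/
noncomputable def weightAt (X : WeightedComplex d) (x : Space d) : ℝ :=
  ∑ σ ∈ X.facets with x ∈ σ, X.weight σ

/-- `w_X ≤ w_Y`, the comparison being made on the maximal cells of a common refinement of `X` and
`Y`, where the weight of a complex is extended by `0` off its support. -/
def WeightLE (X Y : WeightedComplex d) : Prop :=
  ∀ x, x ∉ X.skeleton → x ∉ Y.skeleton → X.weightAt x ≤ Y.weightAt x

/-- `Y = Z 0 + ... + Z (n - 1)` as weighted complexes: the weights add up on the maximal cells of a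
common refinement. -/
def IsSum (Y : WeightedComplex d) {n : ℕ} (Z : Fin n → WeightedComplex d) : Prop :=
  ∀ x, x ∉ Y.skeleton → (∀ i, x ∉ (Z i).skeleton) → Y.weightAt x = ∑ i, (Z i).weightAt x

/-- `v` is the unit normal vector of the cell `σ` along its face `τ` of one dimension less: the unit
vector parallel to `σ`, orthogonal to `τ`, pointing from `τ` into `σ`. -/
def IsUnitNormal (τ σ : Set (Space d)) (v : Space d) : Prop :=
  ‖v‖ = 1 ∧ v ∈ vectorSpan ℝ σ ∧ (∀ u ∈ vectorSpan ℝ τ, ⟪u, v⟫_ℝ = 0) ∧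
    ∀ x ∈ τ, ∀ y ∈ σ, 0 ≤ ⟪v, y - x⟫_ℝ

open Classical in
/-- The (Euclidean) balancing condition: around every cell `τ` of codimension 2 in `ℝᵈ`, the unit
normal vectors of the maximal cells containing `τ`, multiplied by the weights, sum to zero. -/
def Balanced (X : WeightedComplex d) : Prop :=
  ∀ τ ∈ X.cells, dim τ + 2 = d →
    ∃ v : Set (Space d) → Space d,
      (∀ σ ∈ X.facets, τ ⊆ σ → IsUnitNormal τ σ (v σ)) ∧
      ∑ σ ∈ X.facets with τ ⊆ σ, X.weight σ • v σ = 0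

/-- The monomial length: the number of regions (connected components of the complement of the
support) into which `X` divides `ℝᵈ`. -/
noncomputable def mlen (X : WeightedComplex d) : ℕ∞ :=
  ENat.card (ConnectedComponents ↥(X.support)ᶜ)

/-- The factorization length: the least value of `mlen Z₁ + ... + mlen Zₘ - (m - 1)` over all
factorizations `Z₁ + ... + Zₘ`, `m ≥ 1`, of `X` into balanced complexes (here `m = n + 1`). -/
noncomputable def flen (X : WeightedComplex d) : ℕ∞ :=
  ⨅ (n : ℕ) (Z : Fin (n + 1) → WeightedComplex d) (_ : ∀ i, (Z i).Balanced) (_ : X.IsSum Z),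
    (∑ i, (Z i).mlen) - n

/-- `Y` is a balancing of `X`. -/
def IsBalancing (X Y : WeightedComplex d) : Prop :=
  Y.Balanced ∧ X.WeightLE Y

/-- `Y` is a balancing of `X` that is minimal with respect to the length function `len`. -/
def IsMinimalBalancing (len : WeightedComplex d → ℕ∞) (X Y : WeightedComplex d) : Prop :=
  IsBalancing X Y ∧ ∀ Y', IsBalancing X Y' → len Y ≤ len Y'

end WeightedComplex

end TropicalBalancing

namespace TropicalBalancing

open Set Filter Topology

/-! Take the lines y = 0, x = 0, x + y = 3 and let X consist of the six rays left after removing the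
sides of the triangle they bound. Putting the sides back gives a balancing with seven regions; it is
a sum of three lines with two regions each, so its `flen` is at most 2 + 2 + 2 - 2 = 4. Joining the
corners of the triangle to its centroid (1, 1) instead gives a balancing with only six regions.

Everything then follows from `seven_le_mlen`: a balancing of X with `flen` at most 4 has at least
seven regions. An `mlen`-minimal balancing has at most six regions, hence `flen` at least 5; an
`flen`-minimal one has `flen` at most 4, hence at least seven regions. Minimal balancings exist by
well-foundedness and need not be identified.

The geometric input is that the regions of a balanced complex are convex
(`Balanced.segment_subset`), so two points are separated as soon as the segment between them meets
the support. This bounds `mlen` below by the number of outer rays whose tails lie in the support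
(`Balanced.card_le_mlen`), and by 3 if the support contains a piece of a line but not all of it
(`Balanced.three_le_mlen`).

Now let Y = Z 0 + ... + Z n be a balancing of X. Each ray has a tail in some summand. If s rays are
assigned to a summand with N regions, then 2 N ≥ s + 2, strictly when N ≥ 3. Summing, the
factorization has length at least 4, and length 4 forces N ≤ 2 everywhere. A summand carrying a ray
then contains the whole line of that ray, so Y contains all three lines, which separate seven sign
patterns. -/

/-! ### Supports of weighted complexes -/

theorem inner_eq_two (x y : Space 2) : ⟪x, y⟫_ℝ = x 0 * y 0 + x 1 * y 1 := by
  simp [PiLp.inner_apply, Fin.sum_univ_two, mul_comm]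

theorem ext_two {x y : Space 2} (h0 : x 0 = y 0) (h1 : x 1 = y 1) : x = y := by
  ext i; fin_cases i <;> assumption

theorem IsPolyhedron.isClosed {d : ℕ} {P : Set (Space d)} (h : IsPolyhedron P) : IsClosed P := by
  obtain ⟨k, a, b, rfl⟩ := h
  simp only [ofPred_forall]
  exact isClosed_iInter fun i => isClosed_le (by fun_prop) (by fun_prop)

theorem IsPolyhedron.convex {d : ℕ} {P : Set (Space d)} (h : IsPolyhedron P) : Convex ℝ P := by
  obtain ⟨k, a, b, rfl⟩ := h
  simp only [ofPred_forall]
  exact convex_iInter fun i => convex_halfSpace_le (innerₛₗ ℝ (a i)).isLinear _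

namespace WeightedComplex

variable {d : ℕ} (Z : WeightedComplex d)

theorem mem_facets {σ : Set (Space d)} : σ ∈ Z.facets ↔ σ ∈ Z.cells ∧ dim σ + 1 = d := by
  simp [facets]

theorem support_eq_biUnion : Z.support = ⋃ σ ∈ Z.facets, σ := by
  ext x; simp [support]

theorem isClosed_support : IsClosed Z.support := by
  rw [support_eq_biUnion]
  exact Z.facets.finite_toSet.isClosed_biUnion fun σ hσ =>
    (Z.isPolyhedron_of_mem σ (Z.mem_facets.1 hσ).1).isClosed

theorem weight_facet_pos {σ : Set (Space d)} (h : σ ∈ Z.facets) : 0 < Z.weight σ :=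
  Z.weight_pos σ (Z.mem_facets.1 h).1 (Z.mem_facets.1 h).2

open scoped Classical in
theorem weightAt_nonneg (x : Space d) : 0 ≤ Z.weightAt x :=
  Finset.sum_nonneg fun _ hσ => (Z.weight_facet_pos (Finset.mem_filter.1 hσ).1).le

open scoped Classical in
theorem weightAt_pos_iff {x : Space d} : 0 < Z.weightAt x ↔ x ∈ Z.support := by
  constructor
  · intro h
    obtain ⟨σ, hσ, -⟩ := Finset.exists_ne_zero_of_sum_ne_zero h.ne'
    exact ⟨σ, (Finset.mem_filter.1 hσ).1, (Finset.mem_filter.1 hσ).2⟩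
  · rintro ⟨σ, hσ, hx⟩
    exact Finset.sum_pos (fun τ hτ => Z.weight_facet_pos (Finset.mem_filter.1 hτ).1)
      ⟨σ, Finset.mem_filter.2 ⟨hσ, hx⟩⟩

-- Each facet spans a proper affine subspace, so the support has measure zero.
open MeasureTheory in
theorem dense_compl_support : Dense Z.supportᶜ := by
  have h0 : (volume : Measure (Space d)) Z.support = 0 := by
    rw [support_eq_biUnion]
    refine (measure_biUnion_null_iff Z.facets.countable_toSet).2 fun σ hσ => ?_
    refine measure_mono_null (subset_affineSpan ℝ σ)
      (Measure.addHaar_affineSubspace _ _ fun htop => ?_)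
    have hd := (Z.mem_facets.1 hσ).2
    have : vectorSpan ℝ σ = ⊤ := by
      rw [← direction_affineSpan, htop, AffineSubspace.direction_top]
    rw [dim, this, finrank_top, finrank_euclideanSpace_fin] at hd
    omega
  rw [← interior_eq_empty_iff_dense_compl]
  exact Measure.interior_eq_empty_of_null h0

theorem exists_notMem_support {U : Set (Space d)} (hU : IsOpen U) (hne : U.Nonempty) :
    ∃ x ∈ U, x ∉ Z.support :=
  (Z.dense_compl_support.inter_open_nonempty U hU hne)

theorem one_le_mlen : 1 ≤ Z.mlen := by
  obtain ⟨x, -, hx⟩ := Z.exists_notMem_support isOpen_univ univ_nonempty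
  rw [mlen, ENat.one_le_card_iff_nonempty]
  exact ⟨ConnectedComponents.mk ⟨x, hx⟩⟩

end WeightedComplex

/-! ### The balancing condition near a point of the support -/

/-- `u` is a direction in which `K` emanates from `z`. -/
def Emanates (K : Set (Space 2)) (z u : Space 2) : Prop :=
  ∃ ε > 0, ∀ t : ℝ, 0 ≤ t → t ≤ ε → z + t • u ∈ K

theorem Emanates.of_convex {K σ : Set (Space 2)} {z u : Space 2} {c : ℝ} (hσ : Convex ℝ σ)
    (hK : σ ⊆ K) (hz : z ∈ σ) (hc : 0 < c) (hu : z + c • u ∈ σ) : Emanates K z u := by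
  refine ⟨c, hc, fun t ht htc => hK ?_⟩
  have := hσ.add_smul_sub_mem hz hu (t := t / c) ⟨by positivity, by rwa [div_le_one hc]⟩
  rwa [add_sub_cancel_left, smul_smul, div_mul_cancel₀ _ hc.ne'] at this

theorem Emanates.of_smul {K : Set (Space 2)} {z u : Space 2} {c : ℝ} (hc : 0 < c)
    (h : Emanates K z (c • u)) : Emanates K z u := by
  obtain ⟨ε, hε, h⟩ := h
  refine ⟨ε * c, by positivity, fun t ht htc => ?_⟩
  have := h (t / c) (by positivity) (by rwa [div_le_iff₀ hc])
  rwa [smul_smul, div_mul_cancel₀ _ hc.ne'] at this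

theorem Emanates.inner_nonneg {K : Set (Space 2)} {z u n : Space 2} (h : Emanates K z u)
    (hn : ∀ᶠ x in 𝓝 z, ⟪n, x - z⟫_ℝ < 0 → x ∉ K) : 0 ≤ ⟪n, u⟫_ℝ := by
  by_contra! hneg
  obtain ⟨ε, hε, h⟩ := h
  have hc : Tendsto (fun t : ℝ => z + t • u) (𝓝[>] 0) (𝓝 z) := by
    have : Continuous fun t : ℝ => z + t • u := by fun_prop
    simpa using (this.tendsto 0).mono_left nhdsWithin_le_nhds
  obtain ⟨t, ht, ht0, htε⟩ := ((hc.eventually hn).and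
    (Ioc_mem_nhdsGT hε)).exists
  refine ht ?_ (h t ht0.le htε)
  rw [add_sub_cancel_left, inner_smul_right]
  exact mul_neg_of_pos_of_neg ht0 hneg

theorem exists_smul_of_inner_eq_zero {n u y : Space 2} (hn : n ≠ 0) (hu : u ≠ 0)
    (h1 : ⟪n, u⟫_ℝ = 0) (h2 : ⟪n, y⟫_ℝ = 0) : ∃ c : ℝ, y = c • u := by
  rw [inner_eq_two] at h1 h2
  have huu : u 0 * u 0 + u 1 * u 1 ≠ 0 := by
    intro h
    exact hu (ext_two (by simp; nlinarith) (by simp; nlinarith))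
  have hcr : u 0 * y 1 - u 1 * y 0 = 0 := by
    by_contra hcr
    refine hn (ext_two ?_ ?_)
    · have : n 0 * (u 0 * y 1 - u 1 * y 0) = 0 := by linear_combination y 1 * h1 - u 1 * h2
      simpa [hcr] using this
    · have : n 1 * (u 0 * y 1 - u 1 * y 0) = 0 := by linear_combination u 0 * h2 - y 0 * h1
      simpa [hcr] using this
  refine ⟨(u 0 * y 0 + u 1 * y 1) / (u 0 * u 0 + u 1 * u 1), ext_two ?_ ?_⟩
  · simp only [PiLp.smul_apply, smul_eq_mul]
    rw [div_mul_eq_mul_div, eq_div_iff huu]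
    linear_combination (- u 1) * hcr
  · simp only [PiLp.smul_apply, smul_eq_mul]
    rw [div_mul_eq_mul_div, eq_div_iff huu]
    linear_combination (u 0) * hcr

theorem eventually_mem_of_emanates {K : Set (Space 2)} {z u n : Space 2} (hn : n ≠ 0) (hu : u ≠ 0)
    (h : ⟪n, u⟫_ℝ = 0) (h1 : Emanates K z u) (h2 : Emanates K z (-u)) :
    ∀ᶠ x in 𝓝 z, ⟪n, x - z⟫_ℝ = 0 → x ∈ K := by
  obtain ⟨ε₁, hε₁, h1⟩ := h1
  obtain ⟨ε₂, hε₂, h2⟩ := h2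
  have hu' : 0 < ‖u‖ := norm_pos_iff.2 hu
  filter_upwards [Metric.ball_mem_nhds z (ε := min ε₁ ε₂ * ‖u‖) (by positivity)] with x hx hx0
  obtain ⟨c, hc⟩ := exists_smul_of_inner_eq_zero hn hu h hx0
  rw [Metric.mem_ball, dist_eq_norm, hc, norm_smul, mul_lt_mul_iff_left₀ hu', Real.norm_eq_abs,
    lt_min_iff] at hx
  obtain rfl : x = z + c • u := by rw [← hc]; simp
  rcases le_total 0 c with h0 | h0
  · exact h1 c h0 (by rw [abs_of_nonneg h0] at hx; exact hx.1.le)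
  · have := h2 (-c) (by linarith) (by rw [abs_of_nonpos h0] at hx; exact hx.2.le)
    simpa using this

theorem exists_direction {σ : Set (Space 2)} (h : dim σ + 1 = 2) :
    ∃ u : Space 2, u ≠ 0 ∧ (∀ w ∈ vectorSpan ℝ σ, ∃ c : ℝ, w = c • u) ∧
      ∀ z ∈ σ, ∃ y ∈ σ, y ≠ z := by
  have h1 : Module.finrank ℝ (vectorSpan ℝ σ) = 1 := by rw [dim] at h; omega
  obtain ⟨⟨u, hu⟩, hu0, hw⟩ := finrank_eq_one_iff'.1 h1
  refine ⟨u, by simpa using hu0, fun w hwσ => ?_, fun z hz => ?_⟩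
  · obtain ⟨c, hc⟩ := hw ⟨w, hwσ⟩
    exact ⟨c, by simpa using (congrArg Subtype.val hc).symm⟩
  · by_contra! hcon
    have hs : σ.Subsingleton := fun a ha b hb => (hcon a ha).trans (hcon b hb).symm
    rw [(vectorSpan_eq_bot_iff_subsingleton (k := ℝ)).2 hs] at h1
    simp at h1

namespace WeightedComplex

-- Balanced supports cannot stop or bend away from an empty half-plane. The vectors leaving a vertex
-- `z` have nonnegative inner product with `n`, and a positive combination of them is zero, so all
-- are orthogonal to `n`; cancellation then requires both directions of that line. At a point that
-- is not a vertex, the facet itself continues both ways.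
open scoped Classical in
theorem Balanced.eventually_mem_support {Z : WeightedComplex 2} (hZ : Z.Balanced) {z n : Space 2}
    (hz : z ∈ Z.support) (hn : n ≠ 0)
    (h : ∀ᶠ x in 𝓝 z, ⟪n, x - z⟫_ℝ < 0 → x ∉ Z.support) :
    ∀ᶠ x in 𝓝 z, ⟪n, x - z⟫_ℝ = 0 → x ∈ Z.support := by
  obtain ⟨σ, hσ, hzσ⟩ := hz
  have hcon : ∀ τ ∈ Z.facets, Convex ℝ τ := fun τ hτ =>
    (Z.isPolyhedron_of_mem τ (Z.mem_facets.1 hτ).1).convex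
  have hsub : ∀ τ ∈ Z.facets, τ ⊆ Z.support := fun τ hτ x hx => ⟨τ, hτ, hx⟩
  have key : ∀ u : Space 2, u ≠ 0 → Emanates Z.support z u → Emanates Z.support z (-u) →
      ∀ᶠ x in 𝓝 z, ⟪n, x - z⟫_ℝ = 0 → x ∈ Z.support := by
    intro u hu h1 h2
    refine eventually_mem_of_emanates hn hu ?_ h1 h2
    have := h1.inner_nonneg h
    have h3 := h2.inner_nonneg h
    rw [inner_neg_right] at h3
    linarith
  by_cases hcell : ({z} : Set (Space 2)) ∈ Z.cells
  · obtain ⟨v, hv, hsum⟩ := hZ {z} hcell (by simp [dim, vectorSpan_singleton])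
    have hem : ∀ τ ∈ Z.facets, z ∈ τ → Emanates Z.support z (v τ) := by
      intro τ hτ hzτ
      obtain ⟨hv1, hvs, -, hpos⟩ := hv τ hτ (by simpa using hzτ)
      obtain ⟨u, hu, hspan, hne⟩ := exists_direction (Z.mem_facets.1 hτ).2
      obtain ⟨y, hy, hyz⟩ := hne z hzτ
      obtain ⟨a, ha⟩ := hspan _ hvs
      obtain ⟨b, hb⟩ := hspan _ (vsub_mem_vectorSpan ℝ hy hzτ)
      rw [vsub_eq_sub] at hb
      have ha0 : a ≠ 0 := by rintro rfl; simp [ha] at hv1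
      have hb0 : b ≠ 0 := by rintro rfl; exact hyz (sub_eq_zero.1 (by simpa using hb))
      have hyv : y - z = (b / a) • v τ := by rw [hb, ha, smul_smul, div_mul_cancel₀ _ ha0]
      have := hpos z rfl y hy
      rw [hyv, inner_smul_right, real_inner_self_eq_norm_sq, hv1] at this
      refine Emanates.of_convex (hcon τ hτ) (hsub τ hτ) hzτ (c := b / a)
        (lt_of_le_of_ne (by simpa using this) (div_ne_zero hb0 ha0).symm) ?_
      rw [← hyv]; simpa using hy
    have hzero : ∀ τ ∈ Z.facets, z ∈ τ → ⟪n, v τ⟫_ℝ = 0 := by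
      intro τ hτ hzτ
      have h1 := congrArg (fun y => ⟪n, y⟫_ℝ) hsum
      simp only [inner_sum, inner_smul_right, inner_zero_right] at h1
      rw [Finset.sum_eq_zero_iff_of_nonneg] at h1
      · have := h1 τ (by simpa using ⟨hτ, hzτ⟩)
        exact (mul_eq_zero.1 this).resolve_left (Z.weight_facet_pos hτ).ne'
      · intro ρ hρ
        rw [Finset.mem_filter] at hρ
        exact mul_nonneg (Z.weight_facet_pos hρ.1).le
          ((hem ρ hρ.1 (by simpa using hρ.2)).inner_nonneg h)
    have hv1 := (hv σ hσ (by simpa using hzσ)).1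
    have hv0 : v σ ≠ 0 := by intro h0; simp [h0] at hv1
    have h1 := congrArg (fun y => ⟪v σ, y⟫_ℝ) hsum
    simp only [inner_sum, inner_smul_right, inner_zero_right] at h1
    -- In the balancing relation paired with `v σ`, the term of `σ` is positive, so some other term
    -- is negative.
    obtain ⟨ρ, hρ, hzρ, hneg⟩ : ∃ ρ ∈ Z.facets, z ∈ ρ ∧ ⟪v σ, v ρ⟫_ℝ < 0 := by
      by_contra! hcon
      refine h1.not_gt (Finset.sum_pos' (fun ρ hρ =>
        mul_nonneg (Z.weight_facet_pos (Finset.mem_filter.1 hρ).1).le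
          (hcon ρ (Finset.mem_filter.1 hρ).1 (by simpa using (Finset.mem_filter.1 hρ).2)))
        ⟨σ, by simpa using ⟨hσ, hzσ⟩, mul_pos (Z.weight_facet_pos hσ) ?_⟩)
      rw [real_inner_self_eq_norm_sq, hv1]; norm_num
    obtain ⟨c, hc⟩ := exists_smul_of_inner_eq_zero hn hv0 (hzero σ hσ hzσ) (hzero ρ hρ hzρ)
    rw [hc, inner_smul_right, real_inner_self_eq_norm_sq, hv1] at hneg
    refine key _ hv0 (hem σ hσ hzσ) (Emanates.of_smul (c := -c) (by linarith) ?_)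
    rw [neg_smul_neg, ← hc]
    exact hem ρ hρ hzρ
  · obtain ⟨u, hu, hspan, hne⟩ := exists_direction (Z.mem_facets.1 hσ).2
    -- If `σ` had no point beyond `z` in direction `w`, the functional `⟪w, ·⟫` would expose `{z}`
    -- as a face, making it a cell.
    have hex : ∀ w : Space 2, w ≠ 0 → (∀ y ∈ σ, ∃ c : ℝ, y - z = c • w) →
        ∃ c : ℝ, 0 < c ∧ z + c • w ∈ σ := by
      intro w hw hσw
      by_contra! hno
      refine hcell (Z.face_mem σ (Z.mem_facets.1 hσ).1 {z} (singleton_nonempty z) ?_)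
      refine fun _ => ⟨innerSL ℝ w, Subset.antisymm ?_ ?_⟩
      · refine singleton_subset_iff.2 ⟨hzσ, fun y hy => ?_⟩
        obtain ⟨c, hc⟩ := hσw y hy
        have hy' : y = z + c • w := by rw [← hc]; simp
        have hc0 : c ≤ 0 := by
          by_contra! h0
          exact hno c h0 (hy' ▸ hy)
        have : 0 ≤ ⟪w, w⟫_ℝ := real_inner_self_nonneg
        simp only [innerSL_apply_apply, hy', inner_add_right, inner_smul_right]
        nlinarith
      · rintro y ⟨hy, hmax⟩
        obtain ⟨c, hc⟩ := hσw y hy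
        have hy' : y = z + c • w := by rw [← hc]; simp
        have hc0 : c ≤ 0 := by
          by_contra! h0
          exact hno c h0 (hy' ▸ hy)
        have h2 := hmax z hzσ
        have : 0 < ⟪w, w⟫_ℝ := real_inner_self_pos.2 hw
        simp only [innerSL_apply_apply, hy', inner_add_right, inner_smul_right] at h2
        have : c = 0 := by nlinarith
        simp [hy', this]
    have hσu : ∀ y ∈ σ, ∃ c : ℝ, y - z = c • u := fun y hy =>
      hspan _ (vsub_mem_vectorSpan ℝ hy hzσ)
    obtain ⟨c, hc, hcσ⟩ := hex u hu hσu
    obtain ⟨c', hc', hcσ'⟩ := hex (-u) (neg_ne_zero.2 hu) fun y hy => by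
      obtain ⟨c, hc⟩ := hσu y hy
      exact ⟨-c, by simpa using hc⟩
    exact key u hu (.of_convex (hcon σ hσ) (hsub σ hσ) hzσ hc hcσ)
      (.of_convex (hcon σ hσ) (hsub σ hσ) hzσ hc' hcσ')

end WeightedComplex

/-! ### Convexity of the regions -/

open AffineMap

/-- Tube lemma over the compact parameter interval of the segment. -/
theorem isOpen_setOf_segment_subset {E : Type*} [NormedAddCommGroup E] [NormedSpace ℝ E]
    {U : Set E} (hU : IsOpen U) (p : E) : IsOpen {q | segment ℝ p q ⊆ U} := by
  rw [isOpen_iff_mem_nhds]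
  intro q hq
  have : ∀ t ∈ Icc (0 : ℝ) 1, ∀ᶠ y in 𝓝 (q, t), (lineMap p y.1 y.2 : E) ∈ U := by
    intro t ht
    have hc : Continuous fun y : E × ℝ => (lineMap p y.1 y.2 : E) := by
      simp only [lineMap_apply_module]; fun_prop
    exact hc.continuousAt.eventually (hU.mem_nhds (hq (by
      rw [segment_eq_image_lineMap]; exact ⟨t, ht, rfl⟩)))
  filter_upwards [isCompact_Icc.eventually_forall_of_forall_eventually
    (P := fun y t => (lineMap p y t : E) ∈ U) this] with y hy
  rw [segment_eq_image_lineMap]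
  rintro _ ⟨t, ht, rfl⟩
  exact hy t ht

/-- No nonempty open set lies in the line through `p` and `q`. This supplies the nondegenerate
triangle for the sweeping argument. -/
theorem exists_mem_det_ne_zero {V : Set (Space 2)} (hV : IsOpen V) (hne : V.Nonempty)
    {p q : Space 2} (hpq : q ≠ p) :
    ∃ x ∈ V, (x 0 - p 0) * (q 1 - p 1) - (x 1 - p 1) * (q 0 - p 0) ≠ 0 := by
  by_contra! hcon
  obtain ⟨y, hy⟩ := hne
  have hw : ∀ w : Space 2, w 0 * (q 1 - p 1) - w 1 * (q 0 - p 0) = 0 := by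
    intro w
    have hc : Continuous fun t : ℝ => y + t • w := by fun_prop
    have hev : ∀ᶠ t in 𝓝 (0 : ℝ), y + t • w ∈ V :=
      hc.continuousAt.eventually (hV.mem_nhds (by simpa using hy))
    obtain ⟨t, ht, ht0⟩ :=
      ((hev.filter_mono nhdsWithin_le_nhds).and (self_mem_nhdsWithin (s := {0}ᶜ))).exists
    have h0 := hcon y hy
    have h1 := hcon _ ht
    simp only [PiLp.add_apply, PiLp.smul_apply, smul_eq_mul] at h1
    have : t * (w 0 * (q 1 - p 1) - w 1 * (q 0 - p 0)) = 0 := by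
      linear_combination h1 - h0
    exact (mul_eq_zero.1 this).resolve_left ht0
  refine hpq (ext_two ?_ ?_)
  · have := hw !₂[0, 1]
    simp at this; linarith
  · have := hw !₂[1, 0]
    simp at this; linarith

namespace WeightedComplex

/-- If the segments from `p` to the points of the segment from `q` to `s` other than `s` avoid the
support of a balanced complex, then so does the segment from `p` to `s`. -/
theorem Balanced.disjoint_of_triangle {Z : WeightedComplex 2} (hZ : Z.Balanced)
    {p q s : Space 2} (hΔ : (q 0 - p 0) * (s 1 - p 1) - (q 1 - p 1) * (s 0 - p 0) ≠ 0)
    (hs : s ∉ Z.support)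
    (h : ∀ t : ℝ, 0 ≤ t → t < 1 → segment ℝ p (lineMap q s t) ⊆ Z.supportᶜ) :
    segment ℝ p s ⊆ Z.supportᶜ := by
  set Δ := (q 0 - p 0) * (s 1 - p 1) - (q 1 - p 1) * (s 0 - p 0) with hΔdef
  have hp : p ∉ Z.support := h 0 le_rfl one_pos (left_mem_segment ℝ _ _)
  -- Minus the gradient of the coordinate `β` below, so that the side where the inner product is
  -- negative is the side of `q`.
  let n : Space 2 := !₂[-(s 1 - p 1) / Δ, (s 0 - p 0) / Δ]
  have hn : n ≠ 0 := by
    intro h0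
    have e0 : (s 1 - p 1) = 0 := by
      have := congrArg (fun x : Space 2 => x 0) h0
      simp [n, hΔ] at this; linarith
    have e1 : (s 0 - p 0) = 0 := by
      have := congrArg (fun x : Space 2 => x 1) h0
      simpa [n, hΔ] using this
    exact hΔ (by rw [hΔdef, e0, e1]; ring)
  have hloc : ∀ a : ℝ, 0 < a → a < 1 → lineMap p s a ∈ Z.support →
      ∀ᶠ x in 𝓝 (lineMap p s a : Space 2),
        ⟪n, x - lineMap p s a⟫_ℝ = 0 → x ∈ Z.support := by
    intro a ha0 ha1 haK
    refine hZ.eventually_mem_support haK hn ?_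
    -- `β` and `γ` are the coordinates of `x - p` in the basis `q - p`, `s - p`. A point with `β >
    -- 0`, `γ > 0` and `β + γ < 1` lies on a segment from `p` to a point of the segment from `q` to
    -- `s` other than `s`, hence off the support.
    let β : Space 2 → ℝ := fun x => ((x 0 - p 0) * (s 1 - p 1) - (x 1 - p 1) * (s 0 - p 0)) / Δ
    let γ : Space 2 → ℝ := fun x => ((q 0 - p 0) * (x 1 - p 1) - (q 1 - p 1) * (x 0 - p 0)) / Δ
    have hβ : β (lineMap p s a) = 0 := by
      simp only [β, lineMap_apply_module', PiLp.add_apply, PiLp.smul_apply, PiLp.sub_apply,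
        smul_eq_mul]
      rw [div_eq_zero_iff]; left; ring
    have hγ : γ (lineMap p s a) = a := by
      simp only [γ, lineMap_apply_module', PiLp.add_apply, PiLp.smul_apply, PiLp.sub_apply,
        smul_eq_mul]
      rw [div_eq_iff hΔ, hΔdef]; ring
    have hβc : Continuous β := by fun_prop
    have hγc : Continuous γ := by fun_prop
    have e1 : ∀ᶠ x in 𝓝 (lineMap p s a : Space 2), 0 < γ x :=
      hγc.continuousAt.eventually (lt_mem_nhds (by rw [hγ]; exact ha0))
    have e2 : ∀ᶠ x in 𝓝 (lineMap p s a : Space 2), β x + γ x < 1 :=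
      (hβc.add hγc).continuousAt.eventually (gt_mem_nhds (by
      rw [Pi.add_apply, hγ, hβ]; linarith))
    filter_upwards [e1, e2] with x h1 h2 hx
    have hβx : 0 < β x := by
      have : ⟪n, x - lineMap p s a⟫_ℝ = β (lineMap p s a) - β x := by
        simp [inner_eq_two, n, β]; ring
      rw [this, hβ] at hx; linarith
    have hpos : 0 < β x + γ x := by positivity
    refine h (γ x / (β x + γ x)) (by positivity) (by rw [div_lt_one hpos]; linarith) ?_
    rw [segment_eq_image_lineMap]
    refine ⟨β x + γ x, ⟨hpos.le, h2.le⟩, ?_⟩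
    have e0 : x 0 - p 0 = β x * (q 0 - p 0) + γ x * (s 0 - p 0) := by
      simp only [β, γ]; field_simp; rw [hΔdef]; ring
    have e1 : x 1 - p 1 = β x * (q 1 - p 1) + γ x * (s 1 - p 1) := by
      simp only [β, γ]; field_simp; rw [hΔdef]; ring
    apply ext_two
    · simp only [lineMap_apply_module', PiLp.add_apply, PiLp.smul_apply, PiLp.sub_apply,
        smul_eq_mul]
      field_simp
      linear_combination -e0
    · simp only [lineMap_apply_module', PiLp.add_apply, PiLp.smul_apply, PiLp.sub_apply,
        smul_eq_mul]
      field_simp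
      linear_combination -e1
  intro x hx hxK
  have hlc : Continuous fun a : ℝ => (lineMap p s a : Space 2) := lineMap_continuous
  let A : Set ℝ := Icc 0 1 ∩ (fun a : ℝ => (lineMap p s a : Space 2)) ⁻¹' Z.support
  have hA : IsCompact A := isCompact_Icc.inter_right (Z.isClosed_support.preimage hlc)
  have hAne : A.Nonempty := by
    rw [segment_eq_image_lineMap] at hx
    obtain ⟨a, ha, rfl⟩ := hx
    exact ⟨a, ha, hxK⟩
  -- At the first hit `a` the support contains the line through `p` and `s` locally, hence also
  -- points hit earlier.
  obtain ⟨a, ⟨⟨ha0, ha1⟩, haK⟩, hmin⟩ := hA.exists_isLeast hAne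
  have ha0' : 0 < a := lt_of_le_of_ne ha0 (by rintro rfl; simp [hp] at haK)
  have ha1' : a < 1 := lt_of_le_of_ne ha1 (by rintro rfl; simp [hs] at haK)
  have hev := hlc.continuousAt.eventually (hloc a ha0' ha1' haK)
  have hev' := (hev.filter_mono (nhdsWithin_le_nhds (s := Iio a))).and (Ioo_mem_nhdsLT ha0')
  obtain ⟨b, hb, hb0, hba⟩ := hev'.exists
  refine hba.not_ge (hmin ⟨⟨hb0.le, hba.le.trans ha1⟩, hb ?_⟩)
  simp [inner_eq_two, n, lineMap_apply_module']
  ring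

/-- `x` and `y` lie in the same region of the complement of the support. -/
def SameRegion {d : ℕ} (Z : WeightedComplex d) (x y : Space d) : Prop :=
  ∃ (hx : x ∉ Z.support) (hy : y ∉ Z.support),
    (ConnectedComponents.mk ⟨x, hx⟩ : ConnectedComponents ↥(Z.support)ᶜ) =
      ConnectedComponents.mk ⟨y, hy⟩

theorem SameRegion.symm {d : ℕ} {Z : WeightedComplex d} {x y : Space d} (h : Z.SameRegion x y) :
    Z.SameRegion y x := ⟨h.2.1, h.1, h.2.2.symm⟩

theorem SameRegion.trans {d : ℕ} {Z : WeightedComplex d} {x y z : Space d}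
    (h : Z.SameRegion x y) (h' : Z.SameRegion y z) : Z.SameRegion x z :=
  ⟨h.1, h'.2.1, h.2.2.trans h'.2.2⟩

theorem sameRegion_of_isPreconnected {d : ℕ} {Z : WeightedComplex d} {s : Set (Space d)}
    (hs : IsPreconnected s) (hsub : s ⊆ Z.supportᶜ) {x y : Space d} (hx : x ∈ s) (hy : y ∈ s) :
    Z.SameRegion x y := by
  refine ⟨hsub hx, hsub hy, ?_⟩
  have : IsPreconnected ((↑) ⁻¹' s : Set ↥(Z.support)ᶜ) := by
    rw [← Topology.IsInducing.subtypeVal.isPreconnected_image, Subtype.image_preimage_coe,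
      inter_eq_right.2 hsub]
    exact hs
  rw [ConnectedComponents.coe_eq_coe']
  exact this.subset_connectedComponent (mem_preimage.2 hy) (mem_preimage.2 hx)

theorem le_mlen_of_not_sameRegion {d : ℕ} {Z : WeightedComplex d} {ι : Type*} [Fintype ι]
    (x : ι → Space d) (hx : ∀ i, x i ∉ Z.support)
    (hsep : ∀ i j, i ≠ j → ¬ Z.SameRegion (x i) (x j)) :
    (Fintype.card ι : ℕ∞) ≤ Z.mlen := by
  rw [mlen, ← ENat.card_eq_coe_fintype_card]
  refine ENat.card_le_card_of_injective
    (f := fun i => (ConnectedComponents.mk ⟨x i, hx i⟩ : ConnectedComponents ↥(Z.support)ᶜ)) ?_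
  intro i j hij
  by_contra hne
  exact hsep i j hne ⟨_, _, hij⟩

theorem mlen_le_of_cover {d : ℕ} {Z : WeightedComplex d} {ι : Type*} [Fintype ι]
    (s : ι → Set (Space d)) (hs : ∀ i, IsPreconnected (s i)) (hsub : ∀ i, s i ⊆ Z.supportᶜ)
    (hcov : Z.supportᶜ ⊆ ⋃ i, s i) : Z.mlen ≤ Fintype.card ι := by
  rw [mlen, ← ENat.card_eq_coe_fintype_card]
  have hex : ∀ C : ConnectedComponents ↥(Z.support)ᶜ, ∃ x : ↥(Z.support)ᶜ, ∃ i,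
      ConnectedComponents.mk x = C ∧ (x : Space d) ∈ s i := by
    intro C
    obtain ⟨x, rfl⟩ := ConnectedComponents.surjective_coe C
    obtain ⟨i, hi⟩ := mem_iUnion.1 (hcov x.2)
    exact ⟨x, i, rfl, hi⟩
  choose x i hx hi using hex
  refine ENat.card_le_card_of_injective (f := i) fun C C' h => ?_
  rw [← hx C, ← hx C']
  exact (sameRegion_of_isPreconnected (hs _) (hsub _) (hi C) (h ▸ hi C')).2.2

/-- The regions of a balanced complex are convex. -/
theorem Balanced.segment_subset {Z : WeightedComplex 2} (hZ : Z.Balanced)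
    {p q : Space 2} (h : Z.SameRegion p q) : segment ℝ p q ⊆ Z.supportᶜ := by
  obtain ⟨hp, hq, h⟩ := h
  lift p to ↥(Z.support)ᶜ using hp
  lift q to ↥(Z.support)ᶜ using hq
  have hU : IsOpen (Z.support)ᶜ := Z.isClosed_support.isOpen_compl
  have hS := isOpen_setOf_segment_subset hU (p : Space 2)
  set S : Set (Space 2) := {q | segment ℝ (p : Space 2) q ⊆ Z.supportᶜ} with hSdef
  have hpS : (p : Space 2) ∈ S := by
    rw [hSdef, mem_ofPred_eq, segment_same]
    exact singleton_subset_iff.2 p.2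
  -- Sweep the endpoint from a nearby visible point `q'` to `q` within a ball off the support; the
  -- first endpoint not visible from `p` would contradict the triangle lemma.
  have hclosed : ∀ q ∈ (Z.support)ᶜ, q ∈ closure S → q ∈ S := by
    intro q hqU hq
    by_cases hpq : q = p
    · exact hpq ▸ hpS
    obtain ⟨ε, hε, hball⟩ := Metric.isOpen_iff.1 hU q hqU
    obtain ⟨q₀, hq₀⟩ := mem_closure_iff.1 hq _ Metric.isOpen_ball (Metric.mem_ball_self hε)
    have hq' : ∃ q' ∈ Metric.ball q ε ∩ S,
        (q' 0 - p.1 0) * (q 1 - p.1 1) - (q' 1 - p.1 1) * (q 0 - p.1 0) ≠ 0 := 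
      exists_mem_det_ne_zero (Metric.isOpen_ball.inter hS) ⟨q₀, hq₀⟩ hpq
    obtain ⟨q', ⟨hq'b, hq'S⟩, hdet⟩ := hq'
    have hseg : ∀ t ∈ Icc (0 : ℝ) 1, (lineMap q' q t : Space 2) ∉ Z.support := fun t ht =>
      hball ((convex_ball q ε).segment_subset hq'b (Metric.mem_ball_self hε)
        (by rw [segment_eq_image_lineMap]; exact ⟨t, ht, rfl⟩))
    by_contra hqS
    have hlc : Continuous fun a : ℝ => (lineMap q' q a : Space 2) := lineMap_continuous
    let B : Set ℝ := Icc 0 1 ∩ (fun a : ℝ => (lineMap q' q a : Space 2)) ⁻¹' Sᶜ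
    have hB : IsCompact B := isCompact_Icc.inter_right (hS.isClosed_compl.preimage hlc)
    obtain ⟨a, ⟨⟨ha0, ha1⟩, haS⟩, hmin⟩ :=
      hB.exists_isLeast ⟨1, ⟨by norm_num, by simpa using hqS⟩⟩
    have ha0' : 0 < a := lt_of_le_of_ne ha0 (by rintro rfl; simp [hq'S] at haS)
    refine haS (hZ.disjoint_of_triangle (q := q') ?_ (hseg a ⟨ha0, ha1⟩) fun t ht0 ht1 => ?_)
    · simp only [lineMap_apply_module', PiLp.add_apply, PiLp.smul_apply, PiLp.sub_apply,
        smul_eq_mul]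
      intro h0
      exact mul_ne_zero ha0'.ne' hdet (by linear_combination h0)
    · by_contra hno
      rw [lineMap_lineMap_right] at hno
      have hle := hmin ⟨⟨by positivity, by nlinarith⟩, hno⟩
      nlinarith
  have hclopen : IsClopen ((↑) ⁻¹' S : Set ↥(Z.support)ᶜ) := by
    refine ⟨?_, hS.preimage continuous_subtype_val⟩
    rw [← closure_subset_iff_isClosed]
    intro x hx
    exact hclosed x x.2 (continuous_subtype_val.closure_preimage_subset S hx)
  have := hclopen.connectedComponent_subset (x := p) hpS
  exact this (ConnectedComponents.coe_eq_coe'.1 h.symm)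

theorem Balanced.not_sameRegion {Z : WeightedComplex 2} (hZ : Z.Balanced) {x y : Space 2}
    (h : ∃ z ∈ segment ℝ x y, z ∈ Z.support) : ¬ Z.SameRegion x y := by
  obtain ⟨z, hz, hzK⟩ := h
  exact fun hxy => hZ.segment_subset hxy hz hzK

end WeightedComplex

/-! ### Lower bounds for the number of regions -/

/-- The affine function on the plane with coefficient vector `c`. -/
def aff (c : Fin 3 → ℝ) (x : Space 2) : ℝ := c 0 * x 0 + c 1 * x 1 + c 2

theorem continuous_aff (c : Fin 3 → ℝ) : Continuous (aff c) := by
  unfold aff; fun_prop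

theorem aff_neg (c : Fin 3 → ℝ) (x : Space 2) : aff (-c) x = - aff c x := by
  simp [aff]; ring

theorem aff_add_smul (c : Fin 3 → ℝ) (x y : Space 2) (s : ℝ) :
    aff c (x + s • (y - x)) = (1 - s) * aff c x + s * aff c y := by
  simp [aff]; ring

theorem crossing_parameter {a b : ℝ} (h : a * b < 0) :
    a - b ≠ 0 ∧ 0 ≤ a / (a - b) ∧ a / (a - b) ≤ 1 := by
  rcases mul_neg_iff.1 h with ⟨ha, hb⟩ | ⟨ha, hb⟩
  · have : 0 < a - b := by linarith
    exact ⟨this.ne', by positivity, by rw [div_le_one this]; linarith⟩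
  · have : a - b < 0 := by linarith
    exact ⟨this.ne, div_nonneg_of_nonpos ha.le this.le, by rw [div_le_one_of_neg this]; linarith⟩

theorem exists_mem_segment_aff_eq_zero {c : Fin 3 → ℝ} {x y : Space 2} (h : aff c x * aff c y < 0) :
    ∃ z ∈ segment ℝ x y, aff c z = 0 := by
  obtain ⟨hne, h01⟩ := crossing_parameter h
  refine ⟨x + (aff c x / (aff c x - aff c y)) • (y - x), ?_, ?_⟩
  · rw [segment_eq_image']
    exact ⟨_, h01, rfl⟩
  · rw [aff_add_smul]; field_simp; ring

/-- The point where the segment crosses the line depends continuously on both endpoints and tends to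
`b`. The uniformity in the second endpoint is what `Balanced.card_le_mlen` needs when neither
endpoint may be fixed first. -/
theorem eventually_exists_mem_segment {K : Set (Space 2)} {c : Fin 3 → ℝ} {b b' : Space 2}
    (hb : aff c b = 0) (hb' : aff c b' ≠ 0) (hK : ∀ᶠ z in 𝓝 b, aff c z = 0 → z ∈ K) :
    ∀ᶠ p in 𝓝 b ×ˢ 𝓝 b', aff c p.1 * aff c p.2 < 0 → ∃ z ∈ segment ℝ p.1 p.2, z ∈ K := by
  let s : Space 2 × Space 2 → ℝ := fun p => aff c p.1 / (aff c p.1 - aff c p.2)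
  have hs : ContinuousAt s (b, b') :=
    ((continuous_aff c).comp continuous_fst).continuousAt.div
      (((continuous_aff c).comp continuous_fst).sub
        ((continuous_aff c).comp continuous_snd)).continuousAt (by simpa [hb] using hb')
  have hz : ContinuousAt (fun p : Space 2 × Space 2 => p.1 + s p • (p.2 - p.1)) (b, b') := by
    fun_prop
  have hs0 : s (b, b') = 0 := by simp [s, hb]
  have hev : ∀ᶠ p in 𝓝 (b, b'), aff c (p.1 + s p • (p.2 - p.1)) = 0 →
      p.1 + s p • (p.2 - p.1) ∈ K := by
    refine hz.eventually (p := fun z => aff c z = 0 → z ∈ K) ?_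
    simpa [hs0] using hK
  rw [← nhds_prod_eq]
  filter_upwards [hev] with p hp hneg
  obtain ⟨hne, h01⟩ := crossing_parameter hneg
  refine ⟨_, ?_, hp ?_⟩
  · rw [segment_eq_image']
    exact ⟨s p, h01, rfl⟩
  · rw [aff_add_smul]; simp only [s]; field_simp; ring

theorem eventually_exists_mem_segment_right {K : Set (Space 2)} {c : Fin 3 → ℝ} {b y : Space 2}
    (hb : aff c b = 0) (hy : aff c y ≠ 0) (hK : ∀ᶠ z in 𝓝 b, aff c z = 0 → z ∈ K) :
    ∀ᶠ x in 𝓝 b, aff c x * aff c y < 0 → ∃ z ∈ segment ℝ x y, z ∈ K :=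
  ((eventually_exists_mem_segment hb hy hK).curry).mono fun _ h => h.self_of_nhds

/-- The points are chosen from the largest index downwards, so `x j` may be taken close to its limit
depending on all `x k` with `j < k`. -/
theorem exists_pairwise_of_eventually {ι X : Type*} [LinearOrder ι] [Nonempty X] (R : X → X → Prop)
    (F : ι → Filter X) (S : Finset ι) (A : ι → Set X) (hF : ∀ j ∈ S, (F j).NeBot)
    (hA : ∀ j ∈ S, A j ∈ F j)
    (hR : ∀ j ∈ S, ∀ k ∈ S, j < k → ∀ᶠ y in F k, ∀ᶠ x in F j, R x y) :
    ∃ x : ι → X, (∀ j ∈ S, x j ∈ A j) ∧ ∀ j ∈ S, ∀ k ∈ S, j < k → R (x j) (x k) := by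
  classical
  induction S using Finset.induction_on_max generalizing A with
  | empty =>
    exact ⟨fun _ => Classical.arbitrary X, by simp, by simp⟩
  | insert a s hs ih =>
    have ha := hF a (by simp)
    have hev : ∀ᶠ y in F a, (∀ j ∈ s, ∀ᶠ x in F j, R x y) ∧ y ∈ A a :=
      ((Finset.eventually_all s).2 fun j hj =>
        hR j (by simp [hj]) a (by simp) (hs j hj)).and (hA a (by simp))
    obtain ⟨y, hy, hyA⟩ := hev.exists
    obtain ⟨x, hxA, hx⟩ := ih (fun j => A j ∩ {x | R x y}) (fun j hj => hF j (by simp [hj]))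
      (fun j hj => inter_mem (hA j (by simp [hj])) (hy j hj))
      (fun j hj k hk => hR j (by simp [hj]) k (by simp [hk]))
    have has : a ∉ s := fun h => (hs a h).false
    refine ⟨Function.update x a y, fun j hj => ?_, fun j hj k hk hjk => ?_⟩
    · rcases Finset.mem_insert.1 hj with rfl | hj
      · simpa using hyA
      · rw [Function.update_of_ne (hs j hj).ne]
        exact (hxA j hj).1
    · rcases Finset.mem_insert.1 hj with rfl | hj'
      · rcases Finset.mem_insert.1 hk with rfl | hk
        · exact (hjk.false).elim
        · exact ((hs k hk).trans hjk).false.elim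
      · rw [Function.update_of_ne (hs j hj').ne]
        rcases Finset.mem_insert.1 hk with rfl | hk
        · simpa using (hxA j hj').2
        · rw [Function.update_of_ne (hs k hk).ne]
          exact hx j hj' k hk hjk

namespace WeightedComplex

/-- Moving from `b` along the gradient reaches the positive side, and the complement of the support
is dense. -/
theorem frequently_pos_notMem (Z : WeightedComplex 2) {c : Fin 3 → ℝ} (hc : c 0 ≠ 0 ∨ c 1 ≠ 0)
    {b : Space 2} (hb : aff c b = 0) : ∃ᶠ x in 𝓝 b, 0 < aff c x ∧ x ∉ Z.support := by
  rw [frequently_nhds_iff]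
  intro U hbU hU
  have hopen : IsOpen (U ∩ {x | 0 < aff c x}) :=
    hU.inter (isOpen_lt continuous_const (continuous_aff c))
  obtain ⟨x, ⟨hx1, hx2⟩, hx⟩ := Z.exists_notMem_support hopen (by
    let w : Space 2 := !₂[c 0, c 1]
    have hcont : Continuous fun t : ℝ => b + t • w := by fun_prop
    have hev : ∀ᶠ t in 𝓝 (0 : ℝ), b + t • w ∈ U :=
      hcont.continuousAt.eventually (hU.mem_nhds (by simpa using hbU))
    obtain ⟨t, ht, ht0⟩ :=
      ((hev.filter_mono nhdsWithin_le_nhds).and (self_mem_nhdsWithin (s := Ioi 0))).exists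
    refine ⟨_, ht, ?_⟩
    have : aff c (b + t • w) = t * (c 0 ^ 2 + c 1 ^ 2) := by
      unfold aff at hb ⊢
      simp [w]; linear_combination hb
    rw [mem_ofPred_eq, this]
    refine mul_pos ht0 ?_
    rcases hc with h | h <;> positivity)
  exact ⟨x, hx1, hx2, hx⟩

theorem frequently_neg_notMem (Z : WeightedComplex 2) {c : Fin 3 → ℝ} (hc : c 0 ≠ 0 ∨ c 1 ≠ 0)
    {b : Space 2} (hb : aff c b = 0) : ∃ᶠ x in 𝓝 b, aff c x < 0 ∧ x ∉ Z.support := by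
  have := Z.frequently_pos_notMem (c := -c) (by simpa using hc) (b := b) (by simp [aff_neg, hb])
  simpa [aff_neg] using this

theorem Balanced.two_le_mlen {Z : WeightedComplex 2} (hZ : Z.Balanced) {c : Fin 3 → ℝ}
    (hc : c 0 ≠ 0 ∨ c 1 ≠ 0) {b : Space 2} (hb : aff c b = 0)
    (hK : ∀ᶠ z in 𝓝 b, aff c z = 0 → z ∈ Z.support) : 2 ≤ Z.mlen := by
  obtain ⟨y, hy, hyK⟩ := (Z.frequently_neg_notMem hc hb).exists
  obtain ⟨x, ⟨hx, hxK⟩, hxy⟩ := ((Z.frequently_pos_notMem hc hb).and_eventually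
    (eventually_exists_mem_segment_right hb hy.ne hK)).exists
  have hxy := hZ.not_sameRegion (hxy (mul_neg_of_pos_of_neg hx hy))
  refine le_mlen_of_not_sameRegion ![x, y] ?_ ?_
  · intro i; fin_cases i <;> assumption
  · intro i j hij
    fin_cases i <;> fin_cases j
    exacts [(hij rfl).elim, hxy, fun h => hxy h.symm, (hij rfl).elim]

/-- The region of `e` reaches both sides of the line, while near `b` the support separates the
sides. So two points close to `b` on opposite sides are separated from each other, and each is
separated from the part of the region of `e` across the line. -/
theorem Balanced.three_le_mlen {Z : WeightedComplex 2} (hZ : Z.Balanced) {c : Fin 3 → ℝ}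
    (hc : c 0 ≠ 0 ∨ c 1 ≠ 0) {b e : Space 2} (hb : aff c b = 0)
    (hK : ∀ᶠ z in 𝓝 b, aff c z = 0 → z ∈ Z.support) (he : aff c e = 0) (heK : e ∉ Z.support) :
    3 ≤ Z.mlen := by
  obtain ⟨ε, hε, hball⟩ := Metric.isOpen_iff.1 Z.isClosed_support.isOpen_compl e heK
  have hbe : ∀ᶠ x in 𝓝 e, Z.SameRegion x e := by
    filter_upwards [Metric.ball_mem_nhds e hε] with x hx
    exact sameRegion_of_isPreconnected (convex_ball e ε).isPreconnected hball hx
      (Metric.mem_ball_self hε)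
  obtain ⟨e₁, ⟨he₁, -⟩, hr₁⟩ := ((Z.frequently_neg_notMem hc he).and_eventually hbe).exists
  obtain ⟨e₂, ⟨he₂, -⟩, hr₂⟩ := ((Z.frequently_pos_notMem hc he).and_eventually hbe).exists
  obtain ⟨y, ⟨hy, hyK⟩, hye⟩ := ((Z.frequently_neg_notMem hc hb).and_eventually
    (eventually_exists_mem_segment_right hb he₂.ne' hK)).exists
  obtain ⟨x, ⟨hx, hxK⟩, hxy, hxe⟩ := ((Z.frequently_pos_notMem hc hb).and_eventually
    ((eventually_exists_mem_segment_right hb hy.ne hK).and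
      (eventually_exists_mem_segment_right hb he₁.ne hK))).exists
  have hxy := hZ.not_sameRegion (hxy (mul_neg_of_pos_of_neg hx hy))
  have hxe : ¬ Z.SameRegion x e := fun h =>
    hZ.not_sameRegion (hxe (mul_neg_of_pos_of_neg hx he₁)) (h.trans hr₁.symm)
  have hye : ¬ Z.SameRegion y e := fun h =>
    hZ.not_sameRegion (hye (mul_neg_of_neg_of_pos hy he₂)) (h.trans hr₂.symm)
  refine le_mlen_of_not_sameRegion ![x, y, e] ?_ ?_
  · intro i; fin_cases i <;> assumption
  · intro i j hij
    fin_cases i <;> fin_cases j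
    exacts [(hij rfl).elim, hxy, hxe, fun h => hxy h.symm, (hij rfl).elim, hye,
      fun h => hxe h.symm, fun h => hye h.symm, (hij rfl).elim]

/-- A balanced complex has at least as many regions as it has ends. -/
theorem Balanced.card_le_mlen {Z : WeightedComplex 2} (hZ : Z.Balanced) {ι : Type*}
    [LinearOrder ι] (S : Finset ι) (c : ι → Fin 3 → ℝ) (b : ι → Space 2)
    (hc : ∀ j ∈ S, c j 0 ≠ 0 ∨ c j 1 ≠ 0) (hb : ∀ j ∈ S, aff (c j) (b j) = 0)
    (hK : ∀ j ∈ S, ∀ᶠ z in 𝓝 (b j), aff (c j) z = 0 → z ∈ Z.support)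
    (hpair : ∀ j ∈ S, ∀ k ∈ S, j < k →
      aff (c j) (b k) < 0 ∨ aff (c k) (b j) < 0 ∨ c k = - c j) :
    (S.card : ℕ∞) ≤ Z.mlen := by
  -- The region attached to the end `j` is the one just off `b j` on the positive side of its line.
  let A : ι → Set (Space 2) := fun j => {x | 0 < aff (c j) x ∧ x ∉ Z.support}
  obtain ⟨x, hxA, hx⟩ := exists_pairwise_of_eventually
    (fun x y => ¬ Z.SameRegion x y) (fun j => 𝓝 (b j) ⊓ 𝓟 (A j)) S A
    (fun j hj => frequently_mem_iff_neBot.1 (Z.frequently_pos_notMem (hc j hj) (hb j hj)))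
    (fun j hj => mem_inf_of_right (mem_principal_self _)) (by
      intro j hj k hk hjk
      have h1 : ∀ y ∈ A k, aff (c j) y < 0 →
          ∀ᶠ x in 𝓝 (b j) ⊓ 𝓟 (A j), ¬ Z.SameRegion x y := by
        intro y hy hneg
        rw [eventually_inf_principal]
        filter_upwards [eventually_exists_mem_segment_right (hb j hj) hneg.ne (hK j hj)]
          with x hxy hx
        exact hZ.not_sameRegion (hxy (mul_neg_of_pos_of_neg hx.1 hneg))
      rcases hpair j hj k hk hjk with h | h | h
      · rw [eventually_inf_principal]
        filter_upwards [(continuous_aff (c j)).continuousAt.eventually (gt_mem_nhds h)] with y hy hyA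
        exact h1 y hyA hy
      -- The crossing now happens near `b k`, although `y` is chosen before `x`; hence the version
      -- uniform in `x`.
      · have h2 := (eventually_exists_mem_segment (hb k hk) h.ne (hK k hk)).curry
        rw [eventually_inf_principal]
        filter_upwards [h2] with y hy hyA
        refine Filter.Eventually.filter_mono inf_le_left ?_
        filter_upwards [hy, (continuous_aff (c k)).continuousAt.eventually (gt_mem_nhds h)]
          with x hxy hx
        exact fun hr => hZ.not_sameRegion (hxy (mul_neg_of_pos_of_neg hyA.1 hx)) hr.symm
      -- For opposite orientations of one line, `y` is on the negative side of `c j` however close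
      -- it is to the line; `x` is then chosen close enough to `b j` for the crossing to occur
      -- there.
      · rw [eventually_inf_principal]
        refine Filter.Eventually.of_forall fun y hyA => h1 y hyA ?_
        have := hyA.1
        rw [h, aff_neg] at this
        linarith)
  rw [← Fintype.card_coe]
  refine le_mlen_of_not_sameRegion (fun j : S => x j) (fun j => (hxA j j.2).2) fun i j hij => ?_
  rcases lt_or_gt_of_ne (fun h => hij (Subtype.ext h) : (i : ι) ≠ j) with h | h
  · exact hx i i.2 j j.2 h
  · exact fun hr => hx j j.2 i i.2 h hr.symm

end WeightedComplex

/-! ### Sums of complexes and factorizations -/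

namespace WeightedComplex

theorem finite_skeleton (Z : WeightedComplex 2) : Z.skeleton.Finite := by
  have : Z.skeleton ⊆ ⋃ τ ∈ {τ ∈ (Z.cells : Set (Set (Space 2))) | dim τ + 2 ≤ 2}, τ := by
    rintro x ⟨τ, hτ, hd, hx⟩
    exact mem_biUnion (⟨hτ, hd⟩ : τ ∈ {τ ∈ (Z.cells : Set (Set (Space 2))) | dim τ + 2 ≤ 2}) hx
  refine ((Z.cells.finite_toSet.subset (sep_subset _ _)).biUnion fun τ hτ => ?_).subset this
  have h0 : Module.finrank ℝ (vectorSpan ℝ τ) = 0 := by have := hτ.2; rw [dim] at this; omega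
  rw [Submodule.finrank_eq_zero] at h0
  exact ((vectorSpan_eq_bot_iff_subsingleton ℝ).1 h0).finite

theorem finite_iUnion_skeleton {ι : Type*} [Finite ι] (Z : ι → WeightedComplex 2) :
    (⋃ i, (Z i).skeleton).Finite :=
  finite_iUnion fun i => (Z i).finite_skeleton

theorem finite_preimage_line {B : Set (Space 2)} (hB : B.Finite) (a : Space 2) {d : Space 2}
    (hd : d ≠ 0) : {t : ℝ | a + t • d ∈ B}.Finite :=
  hB.preimage (Function.Injective.injOn fun s t h => by
    simpa [hd] using h)

/-- A ray in the support of a summed complex lies eventually in a summand. -/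
theorem IsSum.exists_subray {X Y : WeightedComplex 2} {n : ℕ} {Z : Fin n → WeightedComplex 2}
    (hXY : X.WeightLE Y) (hY : Y.IsSum Z) {a d : Space 2} (hd : d ≠ 0)
    (hray : ∀ t : ℝ, 0 ≤ t → a + t • d ∈ X.support) :
    ∃ i, ∃ T : ℝ, 0 ≤ T ∧ ∀ t, T ≤ t → a + t • d ∈ (Z i).support := by
  let B : Set (Space 2) := X.skeleton ∪ Y.skeleton ∪ ⋃ i, (Z i).skeleton
  have hB : B.Finite := (X.finite_skeleton.union Y.finite_skeleton).union (finite_iUnion_skeleton Z)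
  -- The ray is sampled at integer parameters; only finitely many samples hit a skeleton, where
  -- weights carry no information.
  have hBN : {m : ℕ | a + (m : ℝ) • d ∈ B}.Finite :=
    Finite.preimage (f := fun m : ℕ => (m : ℝ)) Nat.cast_injective.injOn
      (finite_preimage_line hB a hd)
  have hcov : {m : ℕ | a + (m : ℝ) • d ∈ B}ᶜ ⊆
      ⋃ i, ⋃ σ ∈ (Z i).facets, {m : ℕ | a + (m : ℝ) • d ∈ σ} := by
    intro m hm
    simp only [B, mem_compl_iff, mem_ofPred_eq, mem_union, mem_iUnion, not_or, not_exists] at hm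
    have h1 := hXY _ hm.1.1 hm.1.2
    rw [hY _ hm.1.2 hm.2] at h1
    have h2 := X.weightAt_pos_iff.2 (hray m (by positivity))
    obtain ⟨i, -, hi⟩ := Finset.exists_ne_zero_of_sum_ne_zero (h2.trans_le h1).ne'
    obtain ⟨σ, hσ, hx⟩ := (Z i).weightAt_pos_iff.1
      (lt_of_le_of_ne ((Z i).weightAt_nonneg _) hi.symm)
    simp only [mem_iUnion]
    exact ⟨i, σ, hσ, hx⟩
  -- Pigeonhole: finitely many facets cover infinitely many samples, and a convex set containing
  -- infinitely many of them contains a tail of the ray.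
  obtain ⟨i, σ, hσ, hinf⟩ :
      ∃ i, ∃ σ ∈ (Z i).facets, {m : ℕ | a + (m : ℝ) • d ∈ σ}.Infinite := by
    by_contra! hcon
    refine hBN.infinite_compl (Finite.subset (finite_iUnion fun i => ?_) hcov)
    exact (Z i).facets.finite_toSet.biUnion fun σ hσ => hcon i σ hσ
  have hconv : Convex ℝ σ := ((Z i).isPolyhedron_of_mem σ ((Z i).mem_facets.1 hσ).1).convex
  obtain ⟨m, hm⟩ := hinf.nonempty
  refine ⟨i, m, by positivity, fun t ht => ⟨σ, hσ, ?_⟩⟩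
  obtain ⟨k, hk, htk⟩ := hinf.exists_gt ⌈t⌉₊
  have htk' : t < k := (Nat.le_ceil t).trans_lt (by exact_mod_cast htk)
  have hmk : (0 : ℝ) < k - m := by linarith
  have := hconv.add_smul_sub_mem hm hk (t := (t - m) / (k - m))
    ⟨div_nonneg (by linarith) hmk.le, by rw [div_le_one hmk]; linarith⟩
  convert this using 1
  rw [add_sub_add_left_eq_sub, ← sub_smul, smul_smul, div_mul_cancel₀ _ hmk.ne', add_assoc,
    ← add_smul]
  congr 2; ring

/-- Weights of summands are nonnegative, so all points of the line outside a finite set lie in the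
support of `Y`, which is closed. -/
theorem IsSum.mem_support_of_line {Y : WeightedComplex 2} {n : ℕ} {Z : Fin n → WeightedComplex 2}
    (hY : Y.IsSum Z) {i : Fin n} {a d : Space 2} (hd : d ≠ 0)
    (hline : ∀ t : ℝ, a + t • d ∈ (Z i).support) : a ∈ Y.support := by
  let B : Set (Space 2) := Y.skeleton ∪ ⋃ i, (Z i).skeleton
  have hB : B.Finite := Y.finite_skeleton.union (finite_iUnion_skeleton Z)
  have hev : ∀ᶠ t in 𝓝[≠] (0 : ℝ), a + t • d ∈ Y.support := by
    have hfin := (finite_preimage_line hB a hd).sdiff (t := {0})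
    have hmem := hfin.isClosed.isOpen_compl.mem_nhds (x := 0) (by simp)
    filter_upwards [nhdsWithin_le_nhds hmem, self_mem_nhdsWithin] with t ht ht0
    have htB : a + t • d ∉ B := fun h => ht ⟨h, ht0⟩
    simp only [B, mem_union, mem_iUnion, not_or, not_exists] at htB
    rw [← weightAt_pos_iff, hY _ htB.1 htB.2]
    exact Finset.sum_pos' (fun j _ => (Z j).weightAt_nonneg _)
      ⟨i, Finset.mem_univ _, (Z i).weightAt_pos_iff.2 (hline t)⟩
  have hc : Tendsto (fun t : ℝ => a + t • d) (𝓝[≠] 0) (𝓝 a) := by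
    have : Continuous fun t : ℝ => a + t • d := by fun_prop
    simpa using (this.tendsto 0).mono_left nhdsWithin_le_nhds
  exact Y.isClosed_support.mem_of_tendsto hc hev

/-- The bound is stated additively to avoid the truncated subtraction in `flen`. Infinite region
counts are excluded because `⊤ - n = ⊤`. -/
theorem exists_decomposition_of_flen_lt {Y : WeightedComplex 2} {m : ℕ} (h : Y.flen < m) :
    ∃ (n : ℕ) (Z : Fin (n + 1) → WeightedComplex 2) (N : Fin (n + 1) → ℕ),
      (∀ i, (Z i).Balanced) ∧ Y.IsSum Z ∧ (∀ i, (Z i).mlen = N i) ∧ (∀ i, 1 ≤ N i) ∧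
        ∑ i, N i < m + n := by
  simp only [flen, iInf_lt_iff] at h
  obtain ⟨n, Z, hZ, hsum, hlt⟩ := h
  have hfin : ∀ i, (Z i).mlen ≠ ⊤ := by
    intro i hi
    have htop : ∑ i, (Z i).mlen = ⊤ := top_unique
      (hi ▸ Finset.single_le_sum (f := fun i => (Z i).mlen) (fun _ _ => zero_le) (Finset.mem_univ i))
    rw [htop, ENat.top_sub_natCast] at hlt
    exact not_top_lt hlt
  choose N hN using fun i => ENat.ne_top_iff_exists.1 (hfin i)
  refine ⟨n, Z, N, hZ, hsum, fun i => (hN i).symm, fun i => ?_, ?_⟩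
  · have := (Z i).one_le_mlen
    rw [← hN i] at this
    exact_mod_cast this
  · simp only [← hN] at hlt
    have : ∑ i, N i - n < m := by exact_mod_cast hlt
    omega

end WeightedComplex

/-! ### Balancings of the six rays with small factorization length -/

/-- Coefficients of the three lines `y = 0`, `x = 0`, `x + y = 3`, each with both orientations; the
lines are ordered by the slopes of their outer rays. -/
def rayCoeff : Fin 6 → Fin 3 → ℝ :=
  ![![0, 1, 0], ![-1, 0, 0], ![-1, -1, 3], ![0, -1, 0], ![1, 0, 0], ![1, 1, -3]]

/-- The initial points of the six outer rays of the arrangement of three lines. -/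
def rayBase : Fin 6 → Space 2 :=
  ![!₂[3, 0], !₂[0, 3], !₂[0, 3], !₂[0, 0], !₂[0, 0], !₂[3, 0]]

/-- The directions of the six outer rays of the arrangement of three lines. -/
def rayDir : Fin 6 → Space 2 :=
  ![!₂[1, 0], !₂[0, 1], !₂[-1, 1], !₂[-1, 0], !₂[0, -1], !₂[1, -1]]

theorem rayCoeff_ne_zero (j : Fin 6) : rayCoeff j 0 ≠ 0 ∨ rayCoeff j 1 ≠ 0 := by
  fin_cases j <;> simp [rayCoeff]

theorem rayDir_ne_zero (j : Fin 6) : rayDir j ≠ 0 := by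
  intro h
  have h0 := congrArg (fun x : Space 2 => x 0) h
  have h1 := congrArg (fun x : Space 2 => x 1) h
  fin_cases j <;> simp [rayDir] at h0 h1

theorem aff_rayCoeff (j : Fin 6) (t : ℝ) : aff (rayCoeff j) (rayBase j + t • rayDir j) = 0 := by
  fin_cases j <;> simp [rayCoeff, rayBase, rayDir, aff]

theorem exists_of_aff_rayCoeff_eq_zero (j : Fin 6) :
    ∃ f : Space 2 → ℝ, Continuous f ∧ (∀ t, f (rayBase j + t • rayDir j) = t) ∧
      ∀ x, aff (rayCoeff j) x = 0 → x = rayBase j + f x • rayDir j := by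
  fin_cases j
  · refine ⟨fun x => x 0 - 3, by fun_prop, by intro t; simp [rayBase, rayDir], fun x hx => ?_⟩
    simp [rayCoeff, aff] at hx
    apply ext_two <;> simp [rayBase, rayDir, hx]
  · refine ⟨fun x => x 1 - 3, by fun_prop, by intro t; simp [rayBase, rayDir], fun x hx => ?_⟩
    simp [rayCoeff, aff] at hx
    apply ext_two <;> simp [rayBase, rayDir, hx]
  · refine ⟨fun x => x 1 - 3, by fun_prop, by intro t; simp [rayBase, rayDir], fun x hx => ?_⟩
    simp [rayCoeff, aff] at hx
    exact ext_two (by simp [rayBase, rayDir]; linarith) (by simp [rayBase, rayDir])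
  · refine ⟨fun x => - x 0, by fun_prop, by intro t; simp [rayBase, rayDir], fun x hx => ?_⟩
    simp [rayCoeff, aff] at hx
    apply ext_two <;> simp [rayBase, rayDir, hx]
  · refine ⟨fun x => - x 1, by fun_prop, by intro t; simp [rayBase, rayDir], fun x hx => ?_⟩
    simp [rayCoeff, aff] at hx
    apply ext_two <;> simp [rayBase, rayDir, hx]
  · refine ⟨fun x => x 0 - 3, by fun_prop, by intro t; simp [rayBase, rayDir], fun x hx => ?_⟩
    simp [rayCoeff, aff] at hx
    exact ext_two (by simp [rayBase, rayDir]) (by simp [rayBase, rayDir]; linarith)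

theorem eventually_mem_of_subray {K : Set (Space 2)} {j : Fin 6} {T t : ℝ} (htT : T < t)
    (h : ∀ t, T ≤ t → rayBase j + t • rayDir j ∈ K) :
    ∀ᶠ z in 𝓝 (rayBase j + t • rayDir j), aff (rayCoeff j) z = 0 → z ∈ K := by
  obtain ⟨f, hf, hft, hfx⟩ := exists_of_aff_rayCoeff_eq_zero j
  filter_upwards [hf.continuousAt.eventually (lt_mem_nhds (by rwa [hft]))] with z hz hz0
  rw [hfx z hz0]
  exact h _ hz.le

/-- `rayCoeff j` is positive to the left of ray `j`. Of two rays on different lines, at least one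
lies to the right of the line of the other; the last alternative covers the two rays of one line. -/
theorem rayCoeff_pair (j k : Fin 6) (hjk : j < k) {s t : ℝ} (hs : 0 < s) (ht : 0 < t) :
    aff (rayCoeff j) (rayBase k + t • rayDir k) < 0 ∨
      aff (rayCoeff k) (rayBase j + s • rayDir j) < 0 ∨ rayCoeff k = - rayCoeff j := by
  fin_cases j <;> fin_cases k <;>
    first
      | exact absurd hjk (by decide)
      | (left; simp [aff, rayCoeff, rayBase, rayDir]; linarith)
      | (right; left; simp [aff, rayCoeff, rayBase, rayDir]; linarith)
      | (right; right; simp [rayCoeff])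

theorem seven_le_mlen_of_lines {Y : WeightedComplex 2} (hY : Y.Balanced)
    (h : ∀ j x, aff (rayCoeff j) x = 0 → x ∈ Y.support) : 7 ≤ Y.mlen := by
  let c : Fin 3 → Fin 6 := ![0, 4, 5]
  -- Signs of y, x and x + y - 3. The missing triple (-, -, +) is not realized.
  let s : Fin 7 → Fin 3 → ℤ := ![![1, 1, -1], ![1, 1, 1], ![-1, 1, -1], ![-1, 1, 1],
    ![1, -1, -1], ![1, -1, 1], ![-1, -1, -1]]
  have hex : ∀ i, ∃ x : Space 2, (∀ k, 0 < (s i k : ℝ) * aff (rayCoeff (c k)) x) ∧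
      x ∉ Y.support := by
    intro i
    have hopen : IsOpen {x : Space 2 | ∀ k, 0 < (s i k : ℝ) * aff (rayCoeff (c k)) x} := by
      simp only [ofPred_forall]
      exact isOpen_iInter_of_finite fun k =>
        isOpen_lt continuous_const (continuous_const.mul (continuous_aff _))
    refine Y.exists_notMem_support hopen ⟨(![!₂[1, 1], !₂[3, 3], !₂[1, -1], !₂[5, -1],
      !₂[-1, 1], !₂[-1, 5], !₂[-1, -1]] : Fin 7 → Space 2) i, fun k => ?_⟩
    fin_cases i <;> fin_cases k <;> simp [s, c, aff, rayCoeff] <;> norm_num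
  choose x hx hxK using hex
  have hs : ∀ i j, i ≠ j → ∃ k, s i k * s j k = -1 := by decide
  refine le_trans (by simp) (WeightedComplex.le_mlen_of_not_sameRegion x hxK fun i j hij => ?_)
  obtain ⟨k, hk⟩ := hs i j hij
  have hk' : (s i k : ℝ) * s j k = -1 := by exact_mod_cast hk
  have hneg : aff (rayCoeff (c k)) (x i) * aff (rayCoeff (c k)) (x j) < 0 := by
    have := mul_pos (hx i k) (hx j k)
    rw [mul_mul_mul_comm, hk'] at this
    linarith
  obtain ⟨z, hz, hz0⟩ := exists_mem_segment_aff_eq_zero hneg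
  exact hY.not_sameRegion ⟨z, hz, h _ z hz0⟩

/-- A balancing of the outer rays of small factorization length contains the three lines, and so has
at least seven regions. -/
theorem seven_le_mlen {X Y : WeightedComplex 2}
    (hX : ∀ (j : Fin 6) (t : ℝ), 0 ≤ t → rayBase j + t • rayDir j ∈ X.support)
    (hY : X.IsBalancing Y) (hf : Y.flen < (5 : ℕ)) : 7 ≤ Y.mlen := by
  obtain ⟨n, Z, N, hZ, hsum, hN, hN1, hlt⟩ := WeightedComplex.exists_decomposition_of_flen_lt hf
  choose r T hT0 hT using fun j => hsum.exists_subray hY.2 (rayDir_ne_zero j) (hX j)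
  let b : Fin 6 → Space 2 := fun j => rayBase j + (T j + 1) • rayDir j
  have hb : ∀ j, aff (rayCoeff j) (b j) = 0 := fun j => aff_rayCoeff j _
  have hK : ∀ j, ∀ᶠ z in 𝓝 (b j), aff (rayCoeff j) z = 0 → z ∈ (Z (r j)).support := fun j =>
    eventually_mem_of_subray (lt_add_one _) (hT j)
  let S : Fin (n + 1) → Finset (Fin 6) := fun i => Finset.univ.filter fun j => r j = i
  have hS : ∀ i, (S i).card ≤ N i := by
    intro i
    have := (hZ i).card_le_mlen (S i) rayCoeff b (fun j _ => rayCoeff_ne_zero j)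
      (fun j _ => hb j) (fun j hj => (Finset.mem_filter.1 hj).2 ▸ hK j)
      (fun j _ k _ hjk => rayCoeff_pair j k hjk (by linarith [hT0 j]) (by linarith [hT0 k]))
    rw [hN i] at this
    exact_mod_cast this
  -- A summand without rays has `N i ≥ 1`; otherwise add `N i ≥ 2` and `N i ≥ (S i).card`.
  have hS2 : ∀ i, (S i).card + 2 ≤ 2 * N i := by
    intro i
    rcases (S i).eq_empty_or_nonempty with he | ⟨j, hj⟩
    · rw [he, Finset.card_empty]; have := hN1 i; omega
    · have h2 := (hZ (r j)).two_le_mlen (rayCoeff_ne_zero j) (hb j) (hK j)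
      rw [(Finset.mem_filter.1 hj).2, hN i] at h2
      have : 2 ≤ N i := by exact_mod_cast h2
      have := hS i
      omega
  have hcard : ∑ i, (S i).card = 6 := by
    rw [← Finset.card_eq_sum_card_fiberwise (fun j _ => Finset.mem_univ (r j))]; simp
  -- Summing `hS2` over the `n + 1` summands gives `∑ N i ≥ n + 4`, while `hlt` allows no more. A
  -- summand with `N i ≥ 3` would make its inequality strict.
  have hN2 : ∀ i, N i < 3 := by
    intro i
    by_contra! h3
    have hstrict : ∑ i, ((S i).card + 2) < ∑ i, 2 * N i :=
      Finset.sum_lt_sum (fun i _ => hS2 i) ⟨i, Finset.mem_univ i, by have := hS i; omega⟩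
    rw [Finset.sum_add_distrib, hcard, ← Finset.mul_sum] at hstrict
    simp at hstrict
    omega
  refine seven_le_mlen_of_lines hY.1 fun j x hx => ?_
  have hline : ∀ x, aff (rayCoeff j) x = 0 → x ∈ (Z (r j)).support := by
    intro x hx
    by_contra hxK
    have h3 := (hZ (r j)).three_le_mlen (rayCoeff_ne_zero j) (hb j) (hK j) hx hxK
    rw [hN] at h3
    have : 3 ≤ N (r j) := by exact_mod_cast h3
    have := hN2 (r j)
    omega
  obtain ⟨f, -, -, hfx⟩ := exists_of_aff_rayCoeff_eq_zero j
  refine hsum.mem_support_of_line (rayDir_ne_zero j) fun t => hline _ ?_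
  rw [hfx x hx, add_assoc, ← add_smul]
  exact aff_rayCoeff j _

/-! ### Weighted complexes built from edges -/

/-- A ray, or a segment if `bounded`, in the plane, starting at `p` in direction `v`, with the
multiplicity `m` of the vector `v`. -/
structure Edge where
  p : Space 2
  v : Space 2
  bounded : Prop
  m : ℝ

namespace Edge

/-- The points of the edge. -/
def carrier (e : Edge) : Set (Space 2) :=
  {x | ∃ t : ℝ, 0 ≤ t ∧ (e.bounded → t ≤ 1) ∧ x = e.p + t • e.v}

/-- The endpoints of the edge. -/
def ends (e : Edge) : Set (Space 2) :=
  {x | x = e.p ∨ (e.bounded ∧ x = e.p + e.v)}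

open Classical in
/-- The weight of the edge at a point. -/
noncomputable def weightAt (e : Edge) (x : Space 2) : ℝ := if x ∈ e.carrier then e.m * ‖e.v‖ else 0

variable {e : Edge}

theorem weightAt_nonneg (hm : 0 < e.m) (x : Space 2) : 0 ≤ e.weightAt x := by
  unfold weightAt
  split_ifs
  · positivity
  · exact le_rfl

theorem p_mem : e.p ∈ e.carrier := ⟨0, le_rfl, fun _ => zero_le_one, by simp⟩

theorem p_add_v_mem : e.p + e.v ∈ e.carrier := ⟨1, zero_le_one, fun _ => le_rfl, by simp⟩

theorem ends_subset : e.ends ⊆ e.carrier := by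
  rintro x (rfl | ⟨-, rfl⟩)
  exacts [p_mem, p_add_v_mem]

theorem finite_ends : e.ends.Finite :=
  ((finite_singleton e.p).union (finite_singleton (e.p + e.v))).subset (by
    rintro x (rfl | ⟨-, rfl⟩) <;> simp)

theorem vectorSpan_carrier : vectorSpan ℝ e.carrier = Submodule.span ℝ {e.v} := by
  apply le_antisymm
  · rw [vectorSpan, Submodule.span_le]
    rintro _ ⟨_, ⟨s, -, -, rfl⟩, _, ⟨t, -, -, rfl⟩, rfl⟩
    rw [SetLike.mem_coe, Submodule.mem_span_singleton]
    exact ⟨s - t, by simp [sub_smul]⟩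
  · rw [Submodule.span_le, singleton_subset_iff]
    have := vsub_mem_vectorSpan ℝ (p_add_v_mem (e := e)) p_mem
    simpa using this

theorem dim_carrier (h : e.v ≠ 0) : dim e.carrier = 1 := by
  rw [dim, vectorSpan_carrier, finrank_span_singleton h]

theorem inner_self_pos (h : e.v ≠ 0) : 0 < ⟪e.v, e.v⟫_ℝ := real_inner_self_pos.2 h

theorem eq_of_inner {x : Space 2} {v p : Space 2} (hv : v ≠ 0)
    (h : ⟪!₂[-v 1, v 0], x - p⟫_ℝ = 0) : x = p + (⟪v, x - p⟫_ℝ / ⟪v, v⟫_ℝ) • v := by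
  have hvv : v 0 * v 0 + v 1 * v 1 ≠ 0 := by
    have := (real_inner_self_pos.2 hv).ne'
    rwa [inner_eq_two] at this
  rw [inner_eq_two] at h
  simp only [PiLp.sub_apply, Matrix.cons_val_zero, Matrix.cons_val_one] at h
  apply ext_two
  · simp only [PiLp.add_apply, PiLp.smul_apply, smul_eq_mul, inner_eq_two, PiLp.sub_apply]
    rw [← sub_eq_iff_eq_add', div_mul_eq_mul_div, eq_div_iff hvv]
    linear_combination -v 1 * h
  · simp only [PiLp.add_apply, PiLp.smul_apply, smul_eq_mul, inner_eq_two, PiLp.sub_apply]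
    rw [← sub_eq_iff_eq_add', div_mul_eq_mul_div, eq_div_iff hvv]
    linear_combination v 0 * h

theorem isPolyhedron_carrier (h : e.v ≠ 0) : IsPolyhedron e.carrier := by
  have hvv := inner_self_pos h
  let n : Space 2 := !₂[-e.v 1, e.v 0]
  have hnv : ⟪n, e.v⟫_ℝ = 0 := by simp [inner_eq_two, n]; ring
  have hx : ∀ t : ℝ, ⟪n, e.p + t • e.v - e.p⟫_ℝ = 0 := fun t => by
    simp [inner_smul_right, hnv]
  by_cases hb : e.bounded
  · refine ⟨4, ![n, -n, -e.v, e.v],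
      ![⟪n, e.p⟫_ℝ, -⟪n, e.p⟫_ℝ, -⟪e.v, e.p⟫_ℝ, ⟪e.v, e.p⟫_ℝ + ⟪e.v, e.v⟫_ℝ], ?_⟩
    ext x
    simp only [carrier, mem_ofPred_eq, Fin.forall_fin_succ]
    simp only [hb, forall_const, Matrix.cons_val_zero, Matrix.cons_val_succ, inner_neg_left,
      neg_le_neg_iff, IsEmpty.forall_iff, and_true]
    constructor
    · rintro ⟨t, ht0, ht1, rfl⟩
      simp only [inner_add_right, inner_smul_right, hnv]
      exact ⟨by simp, by simp, by nlinarith, by nlinarith⟩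
    · rintro ⟨h1, h2, h3, h4⟩
      refine ⟨⟪e.v, x - e.p⟫_ℝ / ⟪e.v, e.v⟫_ℝ, ?_, ?_, eq_of_inner h ?_⟩
      · rw [inner_sub_right]; exact div_nonneg (by linarith) hvv.le
      · rw [div_le_one hvv, inner_sub_right]; linarith
      · rw [inner_sub_right]; linarith
  · refine ⟨3, ![n, -n, -e.v], ![⟪n, e.p⟫_ℝ, -⟪n, e.p⟫_ℝ, -⟪e.v, e.p⟫_ℝ], ?_⟩
    ext x
    simp only [carrier, mem_ofPred_eq, Fin.forall_fin_succ]
    simp only [hb, true_and, Matrix.cons_val_zero, Matrix.cons_val_succ,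
      inner_neg_left, neg_le_neg_iff, IsEmpty.forall_iff, and_true]
    constructor
    · rintro ⟨t, ht0, rfl⟩
      simp only [inner_add_right, inner_smul_right, hnv]
      exact ⟨by simp, by simp, by nlinarith⟩
    · rintro ⟨h1, h2, h3⟩
      refine ⟨⟪e.v, x - e.p⟫_ℝ / ⟪e.v, e.v⟫_ℝ, ?_, eq_of_inner h ?_⟩
      · rw [inner_sub_right]; exact div_nonneg (by linarith) hvv.le
      · rw [inner_sub_right]; linarith

theorem isPolyhedron_singleton (q : Space 2) : IsPolyhedron {q} := by
  refine ⟨4, ![!₂[1, 0], !₂[-1, 0], !₂[0, 1], !₂[0, -1]], ![q 0, -q 0, q 1, -q 1], ?_⟩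
  ext x
  simp only [mem_singleton_iff, mem_ofPred_eq, Fin.forall_fin_succ]
  simp only [Matrix.cons_val_zero, Matrix.cons_val_succ, inner_eq_two, IsEmpty.forall_iff, and_true]
  constructor
  · rintro rfl; simp
  · intro h
    simp at h
    exact ext_two (by linarith) (by linarith)

theorem isExposed_singleton_of_mem_ends (h : e.v ≠ 0) {q : Space 2} (hq : q ∈ e.ends) :
    IsExposed ℝ e.carrier {q} := by
  have hvv := inner_self_pos h
  rintro -
  rcases hq with rfl | ⟨hb, rfl⟩
  · refine ⟨-innerSL ℝ e.v, Subset.antisymm ?_ ?_⟩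
    · refine singleton_subset_iff.2 ⟨p_mem, ?_⟩
      rintro _ ⟨t, ht, -, rfl⟩
      have := mul_nonneg ht hvv.le
      simpa only [neg_apply, innerSL_apply_apply, inner_add_right,
        inner_smul_right, neg_add_rev, add_le_iff_nonpos_left, neg_nonpos]
    · rintro x ⟨⟨t, ht, -, rfl⟩, hmax⟩
      have := hmax _ p_mem
      simp only [neg_apply, innerSL_apply_apply, inner_add_right,
        inner_smul_right] at this
      have : t = 0 := by nlinarith
      simp [this]
  · refine ⟨innerSL ℝ e.v, Subset.antisymm ?_ ?_⟩
    · refine singleton_subset_iff.2 ⟨p_add_v_mem, ?_⟩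
      rintro _ ⟨t, -, ht, rfl⟩
      simp only [innerSL_apply_apply, inner_add_right, inner_smul_right]
      nlinarith [ht hb]
    · rintro x ⟨⟨t, -, ht, rfl⟩, hmax⟩
      have := hmax _ p_add_v_mem
      simp only [innerSL_apply_apply, inner_add_right, inner_smul_right] at this
      have : t = 1 := by nlinarith [ht hb]
      simp [this]

theorem eq_of_isExposed {F : Set (Space 2)} (hne : F.Nonempty)
    (hF : IsExposed ℝ e.carrier F) : F = e.carrier ∨ ∃ q ∈ e.ends, F = {q} := by
  obtain ⟨l, hl⟩ := hF hne
  have hlt : ∀ t : ℝ, l (e.p + t • e.v) = l e.p + t * l e.v := by simp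
  rcases lt_trichotomy (l e.v) 0 with h0 | h0 | h0
  · refine .inr ⟨e.p, .inl rfl, ?_⟩
    have hp : e.p ∈ F := by
      rw [hl]
      refine ⟨p_mem, ?_⟩
      rintro _ ⟨t, ht, -, rfl⟩
      rw [hlt]; nlinarith
    refine Subset.antisymm ?_ (singleton_subset_iff.2 hp)
    intro x hx
    rw [hl] at hx
    obtain ⟨⟨t, ht, -, rfl⟩, hmax⟩ := hx
    have := hmax _ p_mem
    rw [hlt] at this
    have : t = 0 := by nlinarith
    simp [this]
  · left
    rw [hl]
    refine Subset.antisymm (fun x hx => hx.1) fun x hx => ⟨hx, ?_⟩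
    obtain ⟨t, -, -, rfl⟩ := hx
    rintro _ ⟨s, -, -, rfl⟩
    rw [hlt, hlt, h0]; simp
  · have hb : e.bounded := by
      by_contra hb
      obtain ⟨x, hx⟩ := hne
      rw [hl] at hx
      obtain ⟨⟨t, ht, -, rfl⟩, hmax⟩ := hx
      have := hmax (e.p + (t + 1) • e.v) ⟨t + 1, by linarith, fun h => (hb h).elim, rfl⟩
      rw [hlt, hlt] at this
      nlinarith
    refine .inr ⟨e.p + e.v, .inr ⟨hb, rfl⟩, ?_⟩
    have hp : e.p + e.v ∈ F := by
      rw [hl]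
      refine ⟨p_add_v_mem, ?_⟩
      rintro _ ⟨t, -, ht, rfl⟩
      rw [hlt, map_add]; nlinarith [ht hb]
    refine Subset.antisymm ?_ (singleton_subset_iff.2 hp)
    intro x hx
    rw [hl] at hx
    obtain ⟨⟨t, -, ht, rfl⟩, hmax⟩ := hx
    have := hmax _ p_add_v_mem
    rw [hlt, map_add] at this
    have : t = 1 := by nlinarith [ht hb]
    simp [this]

theorem not_subsingleton (h : e.v ≠ 0) : ¬ e.carrier.Subsingleton := by
  intro hs
  have := hs p_mem (p_add_v_mem (e := e))
  simp [h] at this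

end Edge

/-- A finite planar arrangement of edges that meet at most in common endpoints. -/
structure EdgeFamily (ι : Type) [Fintype ι] where
  edge : ι → Edge
  v_ne : ∀ i, (edge i).v ≠ 0
  m_pos : ∀ i, 0 < (edge i).m
  mem_ends : ∀ i j, i ≠ j → ∀ x ∈ (edge i).carrier, x ∈ (edge j).carrier → x ∈ (edge i).ends
  inter : ∀ i j, i ≠ j → ((edge i).carrier ∩ (edge j).carrier).Subsingleton

theorem dim_singleton (q : Space 2) : dim {q} = 0 := by
  simp [dim, vectorSpan_singleton]

theorem isExposed_empty {P : Set (Space 2)} : IsExposed ℝ P ∅ := fun h => (not_nonempty_empty h).elim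

namespace EdgeFamily

variable {ι : Type} [Fintype ι] (E : EdgeFamily ι)

theorem carrier_injective : Function.Injective fun i => (E.edge i).carrier := by
  intro i j h
  by_contra hij
  have h' : (E.edge i).carrier = (E.edge j).carrier := h
  have := E.inter i j hij
  rw [← h', inter_self] at this
  exact Edge.not_subsingleton (E.v_ne i) this

/-- The set of all endpoints. -/
def vertices : Set (Space 2) := ⋃ i, (E.edge i).ends

theorem finite_vertices : E.vertices.Finite := finite_iUnion fun _ => Edge.finite_ends

theorem isExposed_inter_vertex (i : ι) {q : Space 2} (hq : q ∈ E.vertices) :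
    IsExposed ℝ (E.edge i).carrier ((E.edge i).carrier ∩ {q}) := by
  by_cases hqi : q ∈ (E.edge i).carrier
  · rw [inter_eq_right.2 (singleton_subset_iff.2 hqi)]
    refine Edge.isExposed_singleton_of_mem_ends (E.v_ne i) ?_
    obtain ⟨j, hj⟩ := mem_iUnion.1 hq
    by_cases hij : i = j
    · exact hij ▸ hj
    · exact E.mem_ends i j hij q hqi (Edge.ends_subset hj)
  · rw [inter_singleton_eq_empty.2 hqi]
    exact isExposed_empty

theorem isExposed_inter_singleton (q : Space 2) (P : Set (Space 2)) :
    IsExposed ℝ {q} ({q} ∩ P) := by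
  by_cases h : q ∈ P
  · rw [inter_eq_left.2 (singleton_subset_iff.2 h)]
  · rw [singleton_inter_eq_empty.2 h]
    exact isExposed_empty

theorem isExposed_inter (i j : ι) :
    IsExposed ℝ (E.edge i).carrier ((E.edge i).carrier ∩ (E.edge j).carrier) := by
  by_cases hij : i = j
  · rw [hij, inter_self]
  · rcases (E.inter i j hij).eq_empty_or_singleton with h | ⟨q, h⟩
    · rw [h]; exact isExposed_empty
    · have hq : q ∈ (E.edge i).carrier ∩ (E.edge j).carrier := by rw [h]; rfl
      rw [h]
      exact Edge.isExposed_singleton_of_mem_ends (E.v_ne i) (E.mem_ends i j hij q hq.1 hq.2)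

/-- The edges and the vertices. -/
def cellSet : Set (Set (Space 2)) :=
  range (fun i => (E.edge i).carrier) ∪ (fun q => {q}) '' E.vertices

theorem finite_cellSet : E.cellSet.Finite :=
  (finite_range _).union (E.finite_vertices.image _)

open Classical in
/-- The weighted complex of an arrangement of edges. -/
noncomputable def complex : WeightedComplex 2 where
  cells := E.finite_cellSet.toFinset
  nonempty_of_mem P hP := by
    rcases E.finite_cellSet.mem_toFinset.1 hP with ⟨i, rfl⟩ | ⟨q, -, rfl⟩
    exacts [⟨_, Edge.p_mem⟩, singleton_nonempty q]
  isPolyhedron_of_mem P hP := by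
    rcases E.finite_cellSet.mem_toFinset.1 hP with ⟨i, rfl⟩ | ⟨q, -, rfl⟩
    exacts [Edge.isPolyhedron_carrier (E.v_ne i), Edge.isPolyhedron_singleton q]
  face_mem P hP F hne hF := by
    rw [E.finite_cellSet.mem_toFinset]
    rcases E.finite_cellSet.mem_toFinset.1 hP with ⟨i, rfl⟩ | ⟨q, hq, rfl⟩
    · rcases Edge.eq_of_isExposed hne hF with rfl | ⟨q, hq, rfl⟩
      · exact .inl ⟨i, rfl⟩
      · exact .inr ⟨q, mem_iUnion.2 ⟨i, hq⟩, rfl⟩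
    · rw [(subset_singleton_iff_eq.1 hF.subset).resolve_left hne.ne_empty]
      exact .inr ⟨q, hq, rfl⟩
  inter_face P hP Q hQ := by
    rcases E.finite_cellSet.mem_toFinset.1 hP with ⟨i, rfl⟩ | ⟨q, hq, rfl⟩ <;>
    rcases E.finite_cellSet.mem_toFinset.1 hQ with ⟨j, rfl⟩ | ⟨r, hr, rfl⟩
    · exact ⟨E.isExposed_inter i j, by rw [inter_comm]; exact E.isExposed_inter j i⟩
    · exact ⟨E.isExposed_inter_vertex i hr, by
        rw [inter_comm]; exact isExposed_inter_singleton r _⟩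
    · exact ⟨isExposed_inter_singleton q _, by
        rw [inter_comm]; exact E.isExposed_inter_vertex j hq⟩
    · exact ⟨isExposed_inter_singleton q _, by
        rw [inter_comm]; exact isExposed_inter_singleton r _⟩
  pure P hP := by
    simp only [E.finite_cellSet.mem_toFinset]
    rcases E.finite_cellSet.mem_toFinset.1 hP with ⟨i, rfl⟩ | ⟨q, hq, rfl⟩
    · exact ⟨_, .inl ⟨i, rfl⟩, by simp [Edge.dim_carrier (E.v_ne i)], Subset.rfl⟩
    · obtain ⟨i, hi⟩ := mem_iUnion.1 hq
      exact ⟨_, .inl ⟨i, rfl⟩, by simp [Edge.dim_carrier (E.v_ne i)],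
        singleton_subset_iff.2 (Edge.ends_subset hi)⟩
  -- With weight `m * ‖v‖`, weight times unit vector is `m • v`, so checking balance involves no
  -- square roots.
  weight := Function.extend (fun i => (E.edge i).carrier) (fun i => (E.edge i).m * ‖(E.edge i).v‖) 0
  weight_pos σ hσ hd := by
    rcases E.finite_cellSet.mem_toFinset.1 hσ with ⟨i, rfl⟩ | ⟨q, hq, rfl⟩
    · rw [E.carrier_injective.extend_apply]
      exact mul_pos (E.m_pos i) (norm_pos_iff.2 (E.v_ne i))
    · exact absurd hd (by simp [dim_singleton])

theorem weight_carrier (i : ι) :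
    E.complex.weight (E.edge i).carrier = (E.edge i).m * ‖(E.edge i).v‖ :=
  E.carrier_injective.extend_apply (fun i => (E.edge i).m * ‖(E.edge i).v‖) 0 i

open Classical in
theorem facets_complex : E.complex.facets = Finset.univ.image fun i => (E.edge i).carrier := by
  ext σ
  rw [WeightedComplex.mem_facets]
  simp only [complex, E.finite_cellSet.mem_toFinset, Finset.mem_image, Finset.mem_univ, true_and]
  constructor
  · rintro ⟨⟨i, rfl⟩ | ⟨q, hq, rfl⟩, hd⟩
    · exact ⟨i, rfl⟩
    · exact absurd hd (by simp [dim_singleton])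
  · rintro ⟨i, rfl⟩
    exact ⟨.inl ⟨i, rfl⟩, by simp [Edge.dim_carrier (E.v_ne i)]⟩

theorem support_complex : E.complex.support = ⋃ i, (E.edge i).carrier := by
  ext x
  simp [WeightedComplex.support, facets_complex]

open Classical in
theorem sum_facets {M : Type*} [AddCommMonoid M] (p : Set (Space 2) → Prop)
    (f : Set (Space 2) → M) :
    ∑ σ ∈ E.complex.facets with p σ, f σ =
      ∑ i, if p (E.edge i).carrier then f (E.edge i).carrier else 0 := by
  rw [Finset.sum_filter, facets_complex, Finset.sum_image fun i _ j _ h => E.carrier_injective h]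

theorem weightAt_complex (x : Space 2) :
    E.complex.weightAt x = ∑ i, (E.edge i).weightAt x := by
  rw [WeightedComplex.weightAt, sum_facets]
  simp only [weight_carrier, Edge.weightAt]

open Classical in
/-- An arrangement of edges is balanced if the outgoing vectors sum to zero at every vertex. -/
theorem balanced_complex
    (h : ∀ q ∈ E.vertices, ∑ i, (if q = (E.edge i).p then (E.edge i).m • (E.edge i).v
      else if (E.edge i).bounded ∧ q = (E.edge i).p + (E.edge i).v then
        -((E.edge i).m • (E.edge i).v) else 0) = 0) :
    E.complex.Balanced := by
  intro τ hτ hd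
  obtain ⟨i, rfl⟩ | ⟨q, hq, rfl⟩ := E.finite_cellSet.mem_toFinset.1 hτ
  · simp [Edge.dim_carrier (E.v_ne i)] at hd
  have hends : ∀ i, q ∈ (E.edge i).carrier → q ∈ (E.edge i).ends := by
    intro i hi
    obtain ⟨j, hj⟩ := mem_iUnion.1 hq
    by_cases hij : i = j
    · exact hij ▸ hj
    · exact E.mem_ends i j hij q hi (Edge.ends_subset hj)
  -- The direction in which edge `i` leaves `q`; relevant only if `q` is one of its endpoints.
  let u : ι → Space 2 := fun i => if q = (E.edge i).p then (E.edge i).v else -(E.edge i).v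
  have hu : ∀ i, ‖u i‖ = ‖(E.edge i).v‖ := fun i => by
    simp only [u]; split_ifs <;> simp
  have hw : ∀ i, Function.extend (fun i => (E.edge i).carrier) (fun i => ‖u i‖⁻¹ • u i) 0
      (E.edge i).carrier = ‖u i‖⁻¹ • u i := fun i => E.carrier_injective.extend_apply _ _ i
  refine ⟨Function.extend (fun i => (E.edge i).carrier) (fun i => ‖u i‖⁻¹ • u i) 0, ?_, ?_⟩
  · intro σ hσ hqσ
    rw [facets_complex, Finset.mem_image] at hσ
    obtain ⟨i, -, rfl⟩ := hσ
    have hqi : q ∈ (E.edge i).carrier := by simpa using hqσ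
    have hpos : 0 < ‖u i‖ := by rw [hu]; exact norm_pos_iff.2 (E.v_ne i)
    rw [hw]
    refine ⟨?_, ?_, ?_, ?_⟩
    · rw [norm_smul, norm_inv, norm_norm, inv_mul_cancel₀ hpos.ne']
    · rw [Edge.vectorSpan_carrier]
      refine Submodule.smul_mem _ _ ?_
      simp only [u]
      split_ifs
      · exact Submodule.mem_span_singleton_self _
      · exact neg_mem (Submodule.mem_span_singleton_self _)
    · intro w hw
      rw [vectorSpan_singleton, Submodule.mem_bot] at hw
      simp [hw]
    · rintro x rfl y ⟨t, ht0, ht1, rfl⟩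
      rw [inner_smul_left]
      refine mul_nonneg (by simp) ?_
      have hvv := (Edge.inner_self_pos (E.v_ne i)).le
      rcases eq_or_ne x (E.edge i).p with hp | hp
      · simp only [u, hp, if_true, add_sub_cancel_left, inner_smul_right]
        positivity
      · obtain ⟨hb, hx⟩ := (hends i hqi).resolve_left hp
        simp only [u, hp, if_false]
        rw [hx, add_sub_add_left_eq_sub, inner_sub_right, inner_smul_right, inner_neg_left]
        nlinarith [ht1 hb]
  · rw [sum_facets]
    refine Eq.trans (Finset.sum_congr rfl fun i _ => ?_) (h q hq)
    have hpos : 0 < ‖(E.edge i).v‖ := norm_pos_iff.2 (E.v_ne i)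
    rw [weight_carrier, hw, hu, smul_smul, mul_inv_cancel_right₀ hpos.ne', singleton_subset_iff]
    by_cases hp : q = (E.edge i).p
    · rw [if_pos (hp ▸ Edge.p_mem), if_pos hp]
      simp [u, hp]
    · rw [if_neg hp]
      by_cases hv : (E.edge i).bounded ∧ q = (E.edge i).p + (E.edge i).v
      · rw [if_pos (hv.2 ▸ Edge.p_add_v_mem), if_pos hv]
        simp only [u, hp, if_false, smul_neg]
      · rw [if_neg hv, if_neg fun hq => hv ((hends i hq).resolve_left hp)]

end EdgeFamily

/-! ### The arrangements of rays, lines and medians -/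

theorem ext_two_iff {x y : Space 2} : x = y ↔ x 0 = y 0 ∧ x 1 = y 1 :=
  ⟨fun h => h ▸ ⟨rfl, rfl⟩, fun h => ext_two h.1 h.2⟩

theorem Edge.mem_carrier_iff {e : Edge} {x : Space 2} : x ∈ e.carrier ↔
    ∃ t : ℝ, 0 ≤ t ∧ (e.bounded → t ≤ 1) ∧ x 0 = e.p 0 + t * e.v 0 ∧ x 1 = e.p 1 + t * e.v 1 := by
  simp [Edge.carrier, ext_two_iff]

theorem Edge.mem_ends_iff {e : Edge} {x : Space 2} : x ∈ e.ends ↔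
    (x 0 = e.p 0 ∧ x 1 = e.p 1) ∨ (e.bounded ∧ x 0 = e.p 0 + e.v 0 ∧ x 1 = e.p 1 + e.v 1) := by
  simp [Edge.ends, ext_two_iff]

/-- The edges that are the outer rays of the arrangement of three lines. -/
def rayEdge (j : Fin 6) : Edge := ⟨rayBase j, rayDir j, False, 1⟩

/-- The sides of the triangle formed by the three lines. -/
noncomputable def sideEdge : Fin 3 → Edge :=
  -- The multiplicity 1/3 gives each side the same weight as the two rays on its line.
  ![⟨!₂[0, 0], !₂[3, 0], True, 1 / 3⟩, ⟨!₂[0, 0], !₂[0, 3], True, 1 / 3⟩,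
    ⟨!₂[0, 3], !₂[3, -3], True, 1 / 3⟩]

/-- The segments from the vertices of the triangle to its centroid. -/
def medianEdge : Fin 3 → Edge :=
  ![⟨!₂[0, 0], !₂[1, 1], True, 1⟩, ⟨!₂[3, 0], !₂[-2, 1], True, 1⟩,
    ⟨!₂[0, 3], !₂[1, -2], True, 1⟩]

/-- The linear constraints describing the outer rays. -/
def RayCond : Fin 6 → ℝ → ℝ → Prop :=
  ![fun x y => y = 0 ∧ 3 ≤ x, fun x y => x = 0 ∧ 3 ≤ y, fun x y => x + y = 3 ∧ x ≤ 0,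
    fun x y => y = 0 ∧ x ≤ 0, fun x y => x = 0 ∧ y ≤ 0, fun x y => x + y = 3 ∧ 3 ≤ x]

/-- The linear constraints describing the sides of the triangle. -/
def SideCond : Fin 3 → ℝ → ℝ → Prop :=
  ![fun x y => y = 0 ∧ 0 ≤ x ∧ x ≤ 3, fun x y => x = 0 ∧ 0 ≤ y ∧ y ≤ 3,
    fun x y => x + y = 3 ∧ 0 ≤ x ∧ x ≤ 3]

/-- The linear constraints describing the segments to the centroid. -/
def MedianCond : Fin 3 → ℝ → ℝ → Prop :=
  ![fun x y => x = y ∧ 0 ≤ x ∧ x ≤ 1, fun x y => x + 2 * y = 3 ∧ 1 ≤ x ∧ x ≤ 3,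
    fun x y => 2 * x + y = 3 ∧ 0 ≤ x ∧ x ≤ 1]

theorem mem_rayEdge (j : Fin 6) (x : Space 2) :
    x ∈ (rayEdge j).carrier ↔ RayCond j (x 0) (x 1) := by
  rw [Edge.mem_carrier_iff]
  fin_cases j <;> simp [rayEdge, RayCond, rayBase, rayDir]
  · exact ⟨by rintro ⟨t, h0, h1, h2⟩; constructor <;> linarith,
      fun h => ⟨x 0 - 3, by linarith, by linarith, by linarith⟩⟩
  · exact ⟨by rintro ⟨t, h0, h1, h2⟩; constructor <;> linarith,
      fun h => ⟨x 1 - 3, by linarith, by linarith, by linarith⟩⟩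
  · exact ⟨by rintro ⟨t, h0, h1, h2⟩; constructor <;> linarith,
      fun h => ⟨- x 0, by linarith, by linarith, by linarith⟩⟩
  · exact ⟨by rintro ⟨t, h0, h1, h2⟩; constructor <;> linarith,
      fun h => ⟨- x 0, by linarith, by linarith, by linarith⟩⟩
  · exact ⟨by rintro ⟨t, h0, h1, h2⟩; constructor <;> linarith,
      fun h => ⟨- x 1, by linarith, by linarith, by linarith⟩⟩
  · exact ⟨by rintro ⟨t, h0, h1, h2⟩; constructor <;> linarith,
      fun h => ⟨x 0 - 3, by linarith, by linarith, by linarith⟩⟩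

theorem mem_sideEdge (j : Fin 3) (x : Space 2) :
    x ∈ (sideEdge j).carrier ↔ SideCond j (x 0) (x 1) := by
  rw [Edge.mem_carrier_iff]
  fin_cases j <;> simp [sideEdge, SideCond]
  · exact ⟨by rintro ⟨t, h0, h1, h2, h3⟩; refine ⟨?_, ?_, ?_⟩ <;> linarith,
      fun h => ⟨x 0 / 3, by linarith, by linarith, by linarith, by linarith⟩⟩
  · exact ⟨by rintro ⟨t, h0, h1, h2, h3⟩; refine ⟨?_, ?_, ?_⟩ <;> linarith,
      fun h => ⟨x 1 / 3, by linarith, by linarith, by linarith, by linarith⟩⟩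
  · exact ⟨by rintro ⟨t, h0, h1, h2, h3⟩; refine ⟨?_, ?_, ?_⟩ <;> linarith,
      fun h => ⟨x 0 / 3, by linarith, by linarith, by linarith, by linarith⟩⟩

theorem mem_medianEdge (j : Fin 3) (x : Space 2) :
    x ∈ (medianEdge j).carrier ↔ MedianCond j (x 0) (x 1) := by
  rw [Edge.mem_carrier_iff]
  fin_cases j <;> simp [medianEdge, MedianCond] <;> constructor <;> rintro ⟨h1, h2, h3⟩ <;>
    refine ⟨?_, ?_, ?_⟩ <;> linarith

theorem mem_ends_rayEdge (j : Fin 6) (x : Space 2) :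
    x ∈ (rayEdge j).ends ↔ x 0 = rayBase j 0 ∧ x 1 = rayBase j 1 := by
  simp [Edge.mem_ends_iff, rayEdge]

theorem ray_ray {i j : Fin 6} (hij : i ≠ j) {x : Space 2} (hi : x ∈ (rayEdge i).carrier)
    (hj : x ∈ (rayEdge j).carrier) : x ∈ (rayEdge i).ends := by
  rw [mem_rayEdge] at hi hj
  rw [mem_ends_rayEdge]
  fin_cases i <;> fin_cases j <;>
    first
    | exact absurd hij (by decide)
    | (simp [RayCond] at hi hj; simp [rayBase]; constructor <;> linarith)

theorem ray_side {i : Fin 6} {j : Fin 3} {x : Space 2} (hi : x ∈ (rayEdge i).carrier)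
    (hj : x ∈ (sideEdge j).carrier) : x ∈ (rayEdge i).ends ∧ x ∈ (sideEdge j).ends := by
  rw [mem_rayEdge] at hi
  rw [mem_sideEdge] at hj
  rw [mem_ends_rayEdge, Edge.mem_ends_iff]
  fin_cases i <;> fin_cases j <;> simp [RayCond, SideCond] at hi hj <;>
    simp [rayBase, sideEdge] <;>
    first
    | (exfalso; linarith)
    | exact ⟨⟨by linarith, by linarith⟩, .inl ⟨by linarith, by linarith⟩⟩
    | exact ⟨⟨by linarith, by linarith⟩, .inr ⟨by linarith, by linarith⟩⟩

theorem ray_median {i : Fin 6} {j : Fin 3} {x : Space 2} (hi : x ∈ (rayEdge i).carrier)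
    (hj : x ∈ (medianEdge j).carrier) : x ∈ (rayEdge i).ends ∧ x ∈ (medianEdge j).ends := by
  rw [mem_rayEdge] at hi
  rw [mem_medianEdge] at hj
  rw [mem_ends_rayEdge, Edge.mem_ends_iff]
  fin_cases i <;> fin_cases j <;> simp [RayCond, MedianCond] at hi hj <;>
    simp [rayBase, medianEdge] <;>
    first
    | (exfalso; linarith)
    | exact ⟨⟨by linarith, by linarith⟩, .inl ⟨by linarith, by linarith⟩⟩

theorem side_side {i j : Fin 3} (hij : i ≠ j) {x : Space 2} (hi : x ∈ (sideEdge i).carrier)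
    (hj : x ∈ (sideEdge j).carrier) : x ∈ (sideEdge i).ends := by
  rw [mem_sideEdge] at hi hj
  rw [Edge.mem_ends_iff]
  fin_cases i <;> fin_cases j <;>
    first
    | exact absurd hij (by decide)
    | (simp [SideCond] at hi hj; simp [sideEdge]; left; constructor <;> linarith)
    | (simp [SideCond] at hi hj; simp [sideEdge]; right; constructor <;> linarith)

theorem median_median {i j : Fin 3} (hij : i ≠ j) {x : Space 2} (hi : x ∈ (medianEdge i).carrier)
    (hj : x ∈ (medianEdge j).carrier) : x ∈ (medianEdge i).ends := by
  rw [mem_medianEdge] at hi hj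
  rw [Edge.mem_ends_iff]
  fin_cases i <;> fin_cases j <;>
    first
    | exact absurd hij (by decide)
    | (simp [MedianCond] at hi hj; simp [medianEdge]; right; constructor <;> linarith)

theorem subsingleton_ray {i : Fin 6} : (rayEdge i).ends.Subsingleton := by
  intro x hx y hy
  rw [mem_ends_rayEdge] at hx hy
  exact ext_two (by rw [hx.1, hy.1]) (by rw [hx.2, hy.2])

theorem subsingleton_side_side {i j : Fin 3} (hij : i ≠ j) :
    ((sideEdge i).carrier ∩ (sideEdge j).carrier).Subsingleton := by
  rintro x ⟨hi, hj⟩ y ⟨hi', hj'⟩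
  rw [mem_sideEdge] at hi hj hi' hj'
  fin_cases i <;> fin_cases j <;>
    first
    | exact absurd hij (by decide)
    | (simp [SideCond] at hi hj hi' hj'; apply ext_two <;> linarith)

theorem subsingleton_median_median {i j : Fin 3} (hij : i ≠ j) :
    ((medianEdge i).carrier ∩ (medianEdge j).carrier).Subsingleton := by
  rintro x ⟨hi, hj⟩ y ⟨hi', hj'⟩
  rw [mem_medianEdge] at hi hj hi' hj'
  fin_cases i <;> fin_cases j <;>
    first
    | exact absurd hij (by decide)
    | (simp [MedianCond] at hi hj hi' hj'; apply ext_two <;> linarith)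

/-- The arrangement formed by the outer rays and three segments. -/
def raysWith (s : Fin 3 → Edge) (hv : ∀ i, (s i).v ≠ 0) (hm : ∀ i, 0 < (s i).m)
    (hrs : ∀ (i) (j) (x), x ∈ (rayEdge i).carrier → x ∈ (s j).carrier →
      x ∈ (rayEdge i).ends ∧ x ∈ (s j).ends)
    (hss : ∀ i j, i ≠ j → ∀ x ∈ (s i).carrier, x ∈ (s j).carrier → x ∈ (s i).ends)
    (hsub : ∀ i j, i ≠ j → ((s i).carrier ∩ (s j).carrier).Subsingleton) :
    EdgeFamily (Fin 6 ⊕ Fin 3) where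
  edge := Sum.elim rayEdge s
  v_ne := by
    rintro (i | i)
    · exact rayDir_ne_zero i
    · exact hv i
  m_pos := by
    rintro (i | i)
    · change (0 : ℝ) < 1
      exact one_pos
    · exact hm i
  mem_ends := by
    rintro (i | i) (j | j) hij x hi hj
    · exact ray_ray (mt (congrArg Sum.inl) hij) hi hj
    · exact (hrs i j x hi hj).1
    · exact (hrs j i x hj hi).2
    · exact hss i j (mt (congrArg Sum.inr) hij) x hi hj
  inter := by
    rintro (i | i) (j | j) hij
    · exact subsingleton_ray.anti fun x hx => ray_ray (mt (congrArg Sum.inl) hij) hx.1 hx.2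
    · exact subsingleton_ray.anti fun x hx => (hrs i j x hx.1 hx.2).1
    · exact subsingleton_ray.anti fun x hx => (hrs j i x hx.2 hx.1).1
    · exact hsub i j (mt (congrArg Sum.inr) hij)

/-- The three lines, subdivided at the vertices of the triangle. -/
noncomputable def lineArrangement : EdgeFamily (Fin 6 ⊕ Fin 3) :=
  raysWith sideEdge
    (fun i => by fin_cases i <;> simp [sideEdge])
    (fun i => by fin_cases i <;> simp [sideEdge])
    (fun _ _ _ => ray_side) (fun _ _ h _ => side_side h) (fun _ _ => subsingleton_side_side)

/-- The outer rays together with the segments from the vertices of the triangle to its centroid. -/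
def medianArrangement : EdgeFamily (Fin 6 ⊕ Fin 3) :=
  raysWith medianEdge
    (fun i => by fin_cases i <;> simp [medianEdge])
    (fun i => by fin_cases i <;> simp [medianEdge])
    (fun _ _ _ => ray_median) (fun _ _ h _ => median_median h)
    (fun _ _ => subsingleton_median_median)

/-- A subarrangement. -/
def EdgeFamily.comap {ι κ : Type} [Fintype ι] [Fintype κ] (E : EdgeFamily ι) (f : κ → ι)
    (hf : Function.Injective f) : EdgeFamily κ where
  edge i := E.edge (f i)
  v_ne i := E.v_ne _
  m_pos i := E.m_pos _
  mem_ends i j hij := E.mem_ends _ _ (hf.ne hij)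
  inter i j hij := E.inter _ _ (hf.ne hij)

/-- The arrangement of the outer rays. -/
noncomputable def rayArrangement : EdgeFamily (Fin 6) :=
  lineArrangement.comap Sum.inl Sum.inl_injective

/-- The edges forming one of the three lines. -/
def lineIndex (k : Fin 3) : Fin 3 → Fin 6 ⊕ Fin 3 :=
  ![.inl (k.castLE (by decide)), .inl (k.natAdd 3), .inr k]

theorem lineIndex_injective (k : Fin 3) : Function.Injective (lineIndex k) := by
  revert k; decide

/-- One of the three lines. -/
noncomputable def singleLine (k : Fin 3) : EdgeFamily (Fin 3) :=
  lineArrangement.comap (lineIndex k) (lineIndex_injective k)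

theorem lineArrangement_edge_inl (j : Fin 6) : lineArrangement.edge (.inl j) = rayEdge j := rfl

theorem medianArrangement_edge_inl (j : Fin 6) : medianArrangement.edge (.inl j) = rayEdge j := rfl

theorem lineArrangement_edge_inr (j : Fin 3) : lineArrangement.edge (.inr j) = sideEdge j := rfl

theorem medianArrangement_edge_inr (j : Fin 3) :
    medianArrangement.edge (.inr j) = medianEdge j := rfl

theorem rayArrangement_edge (j : Fin 6) : rayArrangement.edge j = rayEdge j := rfl

theorem rayArrangement_weightLE_line :
    rayArrangement.complex.WeightLE lineArrangement.complex := by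
  intro x _ _
  rw [EdgeFamily.weightAt_complex, EdgeFamily.weightAt_complex, Fintype.sum_sum_type]
  simp only [rayArrangement_edge, lineArrangement_edge_inl]
  refine le_add_of_nonneg_right (Finset.sum_nonneg fun i _ => ?_)
  exact Edge.weightAt_nonneg (lineArrangement.m_pos (.inr i)) x

theorem rayArrangement_weightLE_median :
    rayArrangement.complex.WeightLE medianArrangement.complex := by
  intro x _ _
  rw [EdgeFamily.weightAt_complex, EdgeFamily.weightAt_complex, Fintype.sum_sum_type]
  simp only [rayArrangement_edge, medianArrangement_edge_inl]
  refine le_add_of_nonneg_right (Finset.sum_nonneg fun i _ => ?_)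
  exact Edge.weightAt_nonneg (medianArrangement.m_pos (.inr i)) x

theorem ray_mem_support (j : Fin 6) (t : ℝ) (ht : 0 ≤ t) :
    rayBase j + t • rayDir j ∈ rayArrangement.complex.support := by
  rw [EdgeFamily.support_complex]
  have : rayBase j + t • rayDir j ∈ (rayEdge j).carrier := ⟨t, ht, fun h => h.elim, rfl⟩
  exact mem_iUnion.2 ⟨j, this⟩

theorem sum_lineIndex (f : Fin 6 ⊕ Fin 3 → ℝ) :
    ∑ i, f i = ∑ k, ∑ i, f (lineIndex k i) := by
  have h : ∀ k : Fin 3, ∑ i, f (lineIndex k i) =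
      f (.inl (k.castLE (by decide))) + f (.inl (k.natAdd 3)) + f (.inr k) := fun k =>
    Fin.sum_univ_three _
  simp only [h, Fintype.sum_sum_type, Fin.sum_univ_three, Fin.sum_univ_six]
  change _ = f (.inl 0) + f (.inl 3) + f (.inr 0) + (f (.inl 1) + f (.inl 4) + f (.inr 1)) +
    (f (.inl 2) + f (.inl 5) + f (.inr 2))
  ring

theorem lineArrangement_isSum :
    lineArrangement.complex.IsSum fun k => (singleLine k).complex := by
  intro x _ _
  simp only [EdgeFamily.weightAt_complex]
  exact sum_lineIndex fun i => (lineArrangement.edge i).weightAt x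

theorem rayEdge_ends (j : Fin 6) : (rayEdge j).ends = {rayBase j} := by
  ext x; simp [Edge.ends, rayEdge]

/-- The vertices of the triangle. -/
def corner : Fin 3 → Space 2 := ![!₂[0, 0], !₂[3, 0], !₂[0, 3]]

theorem exists_rayBase_eq_corner (j : Fin 6) : ∃ k, rayBase j = corner k := by
  fin_cases j
  exacts [⟨1, rfl⟩, ⟨2, rfl⟩, ⟨2, rfl⟩, ⟨0, rfl⟩, ⟨0, rfl⟩, ⟨1, rfl⟩]

theorem vertices_lineArrangement : lineArrangement.vertices ⊆ range corner := by
  refine iUnion_subset ?_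
  rintro (j | j) x hx
  · rw [lineArrangement_edge_inl, rayEdge_ends] at hx
    obtain ⟨k, hk⟩ := exists_rayBase_eq_corner j
    exact ⟨k, by rw [← hk, hx]⟩
  · rw [lineArrangement_edge_inr, Edge.mem_ends_iff] at hx
    fin_cases j <;> simp [sideEdge] at hx <;> rcases hx with hx | hx
    exacts [⟨0, ext_two (by simp [corner, hx]) (by simp [corner, hx])⟩,
      ⟨1, ext_two (by simp [corner, hx]) (by simp [corner, hx])⟩,
      ⟨0, ext_two (by simp [corner, hx]) (by simp [corner, hx])⟩,
      ⟨2, ext_two (by simp [corner, hx]) (by simp [corner, hx])⟩,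
      ⟨2, ext_two (by simp [corner, hx]) (by simp [corner, hx])⟩,
      ⟨1, ext_two (by simp [corner, hx]) (by simp [corner, hx])⟩]

theorem vertices_medianArrangement :
    medianArrangement.vertices ⊆ insert !₂[1, 1] (range corner) := by
  refine iUnion_subset ?_
  rintro (j | j) x hx
  · rw [medianArrangement_edge_inl, rayEdge_ends] at hx
    obtain ⟨k, hk⟩ := exists_rayBase_eq_corner j
    exact .inr ⟨k, by rw [← hk, hx]⟩
  · rw [medianArrangement_edge_inr, Edge.mem_ends_iff] at hx
    fin_cases j <;> simp [medianEdge] at hx <;> rcases hx with hx | hx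
    exacts [.inr ⟨0, ext_two (by simp [corner, hx]) (by simp [corner, hx])⟩,
      .inl (ext_two (by simp [hx]) (by simp [hx])),
      .inr ⟨1, ext_two (by simp [corner, hx]) (by simp [corner, hx])⟩,
      .inl (ext_two (by simp [hx]; norm_num) (by simp [hx])),
      .inr ⟨2, ext_two (by simp [corner, hx]) (by simp [corner, hx])⟩,
      .inl (ext_two (by simp [hx]) (by simp [hx]; norm_num))]

open Classical in
/-- The vector, with multiplicity, in which an edge leaves the point `q`. -/
noncomputable def Edge.outgoing (e : Edge) (q : Space 2) : Space 2 :=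
  if q = e.p then e.m • e.v else if e.bounded ∧ q = e.p + e.v then -(e.m • e.v) else 0

theorem balanced_lineArrangement : lineArrangement.complex.Balanced := by
  refine EdgeFamily.balanced_complex _ fun q hq => ?_
  change ∑ i, (lineArrangement.edge i).outgoing q = 0
  obtain ⟨k, rfl⟩ := vertices_lineArrangement hq
  simp only [Fintype.sum_sum_type, lineArrangement_edge_inl, lineArrangement_edge_inr,
    Fin.sum_univ_six, Fin.sum_univ_three]
  fin_cases k <;>
    simp [Edge.outgoing, rayEdge, sideEdge, rayBase, rayDir, corner, ext_two_iff]

/-- At each corner the median vector is minus the sum of the two ray directions there, and the three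
median vectors (1, 1), (-2, 1), (1, -2) sum to zero at the centroid. -/
theorem balanced_medianArrangement : medianArrangement.complex.Balanced := by
  refine EdgeFamily.balanced_complex _ fun q hq => ?_
  change ∑ i, (medianArrangement.edge i).outgoing q = 0
  simp only [Fintype.sum_sum_type, medianArrangement_edge_inl, medianArrangement_edge_inr,
    Fin.sum_univ_six, Fin.sum_univ_three]
  obtain rfl | ⟨k, rfl⟩ := vertices_medianArrangement hq
  · simp [Edge.outgoing, rayEdge, medianEdge, rayBase, rayDir, ext_two_iff]; norm_num
  · fin_cases k <;>
      simp [Edge.outgoing, rayEdge, medianEdge, rayBase, rayDir, corner, ext_two_iff] <;> norm_num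

theorem singleLine_edge (k i : Fin 3) :
    (singleLine k).edge i = ![rayEdge (k.castLE (by decide)), rayEdge (k.natAdd 3), sideEdge k] i := by
  fin_cases i <;> rfl

theorem balanced_singleLine (k : Fin 3) : (singleLine k).complex.Balanced := by
  refine EdgeFamily.balanced_complex _ fun q hq => ?_
  change ∑ i, ((singleLine k).edge i).outgoing q = 0
  have hq' : q ∈ lineArrangement.vertices := by
    obtain ⟨i, hi⟩ := mem_iUnion.1 hq
    exact mem_iUnion.2 ⟨lineIndex k i, hi⟩
  obtain ⟨l, rfl⟩ := vertices_lineArrangement hq'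
  simp only [singleLine_edge, Fin.sum_univ_three]
  fin_cases k <;> fin_cases l <;>
    simp [Edge.outgoing, rayEdge, sideEdge, rayBase, rayDir, corner, ext_two_iff]

/-! ### Upper bounds for the two lengths, and the conclusion -/

theorem convex_aff_pos (c : Fin 3 → ℝ) : Convex ℝ {x | 0 < aff c x} := by
  intro x hx y hy a b ha hb hab
  have h : aff c (a • x + b • y) = a * aff c x + b * aff c y := by
    simp [aff]; linear_combination -c 2 * hab
  rw [mem_ofPred_eq] at hx hy ⊢
  rw [h]
  rcases ha.eq_or_lt with rfl | ha
  · have : b = 1 := by linarith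
    simp [this, hy]
  · positivity

theorem mlen_singleLine (k : Fin 3) : (singleLine k).complex.mlen ≤ 2 := by
  have hsupp : ∀ x, x ∈ (singleLine k).complex.support ↔ aff (rayCoeff (k.castLE (by decide))) x = 0 := by
    intro x
    rw [EdgeFamily.support_complex, mem_iUnion]
    simp only [singleLine_edge, Fin.exists_fin_succ, IsEmpty.exists_iff, or_false]
    change x ∈ (rayEdge _).carrier ∨ x ∈ (rayEdge _).carrier ∨ x ∈ (sideEdge _).carrier ↔ _
    rw [mem_rayEdge, mem_rayEdge, mem_sideEdge]
    fin_cases k <;> simp [RayCond, SideCond, aff, rayCoeff] <;> grind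
  refine (WeightedComplex.mlen_le_of_cover (ι := Fin 2)
    ![{x | 0 < aff (rayCoeff (k.castLE (by decide))) x},
      {x | 0 < aff (-rayCoeff (k.castLE (by decide))) x}] ?_ ?_ ?_).trans (by simp)
  · intro i
    fin_cases i <;> exact (convex_aff_pos _).isPreconnected
  · intro i x hx hxK
    rw [hsupp] at hxK
    fin_cases i <;> simp [aff_neg, hxK] at hx
  · intro x hx
    rw [mem_compl_iff, hsupp] at hx
    rw [mem_iUnion]
    rcases lt_or_gt_of_ne hx with h | h
    · exact ⟨1, by simpa [aff_neg] using h⟩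
    · exact ⟨0, h⟩

/-- The hypotheses say that (x, y) avoids the six rays and three medians; the alternatives are the
regions of `regionCoeff`. Each is convex, which makes the count in `mlen_medianArrangement` a
covering argument. -/
theorem exists_region (x y : ℝ) (h0 : y = 0 → x < 3) (h1 : x = 0 → y < 3) (h2 : x + y = 3 → 0 < x)
    (h3 : y = 0 → 0 < x) (h4 : x = 0 → 0 < y) (h5 : x + y = 3 → x < 3)
    (h6 : x = y → 0 ≤ x → 1 < x) (h7 : x + 2 * y = 3 → 1 ≤ x → 3 < x)
    (h8 : 2 * x + y = 3 → 0 ≤ x → 1 < x) :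
    (x < 0 ∧ y < 0) ∨ (y < 0 ∧ 3 < x + y) ∨ (x < 0 ∧ 3 < x + y) ∨
    (0 < x ∧ y < x ∧ x + 2 * y < 3 ∧ x + y < 3) ∨ (0 < y ∧ x < y ∧ 2 * x + y < 3 ∧ x + y < 3) ∨
    (0 < x ∧ 0 < y ∧ 3 < x + 2 * y ∧ 3 < 2 * x + y) := by
  grind (splits := 30)

/-- Coefficients of the affine functions that are positive on the six regions into which the outer
rays and the segments to the centroid divide the plane. -/
def regionCoeff : Fin 6 → Fin 4 → Fin 3 → ℝ :=
  ![![![-1, 0, 0], ![0, -1, 0], ![0, 0, 1], ![0, 0, 1]],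
    ![![0, -1, 0], ![1, 1, -3], ![0, 0, 1], ![0, 0, 1]],
    ![![-1, 0, 0], ![1, 1, -3], ![0, 0, 1], ![0, 0, 1]],
    ![![1, 0, 0], ![1, -1, 0], ![-1, -2, 3], ![-1, -1, 3]],
    ![![0, 1, 0], ![-1, 1, 0], ![-2, -1, 3], ![-1, -1, 3]],
    ![![1, 0, 0], ![0, 1, 0], ![1, 2, -3], ![2, 1, -3]]]

theorem mlen_medianArrangement : medianArrangement.complex.mlen ≤ 6 := by
  have hsupp : ∀ x, x ∈ medianArrangement.complex.support ↔
      (∃ j, RayCond j (x 0) (x 1)) ∨ ∃ j, MedianCond j (x 0) (x 1) := by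
    intro x
    simp only [EdgeFamily.support_complex, mem_iUnion, Sum.exists, medianArrangement_edge_inl,
      medianArrangement_edge_inr, mem_rayEdge, mem_medianEdge]
  -- The rows (0, 0, 1) of `regionCoeff` are the constant 1, padding the three wedges that need only
  -- two inequalities.
  refine (WeightedComplex.mlen_le_of_cover (ι := Fin 6)
    (fun i => ⋂ k, {x | 0 < aff (regionCoeff i k) x}) ?_ ?_ ?_).trans (by simp)
  · exact fun i => (convex_iInter fun k => convex_aff_pos _).isPreconnected
  · intro i x hx hxK
    rw [hsupp] at hxK
    simp only [mem_iInter, mem_ofPred_eq] at hx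
    have h0 := hx 0
    have h1 := hx 1
    have h2 := hx 2
    have h3 := hx 3
    obtain ⟨j, hj⟩ | ⟨j, hj⟩ := hxK
    · fin_cases i <;> fin_cases j <;> simp [aff, regionCoeff] at h0 h1 h2 h3 <;>
        simp [RayCond] at hj <;> linarith
    · fin_cases i <;> fin_cases j <;> simp [aff, regionCoeff] at h0 h1 h2 h3 <;>
        simp [MedianCond] at hj <;> linarith
  · intro x hx
    rw [mem_compl_iff, hsupp] at hx
    simp only [Fin.exists_fin_succ, IsEmpty.exists_iff, or_false, not_or] at hx
    simp [RayCond, MedianCond] at hx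
    have := exists_region (x 0) (x 1)
    simp only [mem_iUnion, mem_iInter, mem_ofPred_eq, Fin.exists_fin_succ, Fin.forall_fin_succ]
    simp [aff, regionCoeff]
    grind

theorem flen_lineArrangement : lineArrangement.complex.flen ≤ 4 := by
  have h : ∑ k, (singleLine k).complex.mlen ≤ 6 :=
    (Finset.sum_le_sum fun k _ => mlen_singleLine k).trans (by norm_num)
  have h' : (∑ k, (singleLine k).complex.mlen) - (2 : ℕ) ≤ 4 :=
    (tsub_le_tsub_right h _).trans (by decide)
  rw [WeightedComplex.flen]
  exact iInf_le_of_le 2 (iInf_le_of_le (fun k => (singleLine k).complex)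
    (iInf_le_of_le balanced_singleLine (iInf_le_of_le lineArrangement_isSum h')))

theorem WeightedComplex.exists_isMinimalBalancing {d : ℕ} (len : WeightedComplex d → ℕ∞)
    {X Y : WeightedComplex d} (hY : X.IsBalancing Y) :
    ∃ Y', IsMinimalBalancing len X Y' ∧ len Y' ≤ len Y := by
  obtain ⟨Y', hY', hmin⟩ := (InvImage.wf len wellFounded_lt).has_min {Y | X.IsBalancing Y} ⟨Y, hY⟩
  exact ⟨Y', ⟨hY', fun Z hZ => not_lt.1 (hmin Z hZ)⟩, not_lt.1 (hmin Y hY)⟩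

end TropicalBalancing

theorem theorem2 :
    ∃ X Y₁ Y₂ : TropicalBalancing.WeightedComplex 2,
      TropicalBalancing.WeightedComplex.IsMinimalBalancing
        TropicalBalancing.WeightedComplex.mlen X Y₁ ∧
      TropicalBalancing.WeightedComplex.IsMinimalBalancing
        TropicalBalancing.WeightedComplex.flen X Y₂ ∧
      Y₁.mlen < Y₂.mlen ∧ Y₂.flen < Y₁.flen := by
  open TropicalBalancing in
  obtain ⟨Y₁, h₁, hle₁⟩ := WeightedComplex.exists_isMinimalBalancing WeightedComplex.mlen
    (⟨balanced_medianArrangement, rayArrangement_weightLE_median⟩ :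
      rayArrangement.complex.IsBalancing medianArrangement.complex)
  obtain ⟨Y₂, h₂, hle₂⟩ := WeightedComplex.exists_isMinimalBalancing WeightedComplex.flen
    (⟨balanced_lineArrangement, rayArrangement_weightLE_line⟩ :
      rayArrangement.complex.IsBalancing lineArrangement.complex)
  have hm₁ : Y₁.mlen < 7 := (hle₁.trans mlen_medianArrangement).trans_lt (by decide)
  have hf₂ : Y₂.flen < (5 : ℕ) := (hle₂.trans flen_lineArrangement).trans_lt (by decide)
  refine ⟨_, Y₁, Y₂, h₁, h₂, hm₁.trans_le (seven_le_mlen ray_mem_support h₂.1 hf₂), ?_⟩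
  -- Otherwise `Y₁` too would have `flen` below 5, and so at least seven regions.
  by_contra! hle
  exact hm₁.not_ge (seven_le_mlen ray_mem_support h₁.1 (hle.trans_lt hf₂))
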